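/- **Corollary 1.4** (cor:weinstein). For $\alpha>0$ let $X_\alpha=(S^2\times S^2,\omega_\alpha)$ with $\omega_\alpha=2(\alpha+1)\,\omega_{S^2}\oplus 2\alpha\,\omega_{S^2}$, where $\omega_{S^2}$ is the rotation invariant area form of total area $1$ on the unit sphere $S^2\subset\mathbb R^3$. For $a>0$ and $h\in(-\tfrac a2,\tfrac a2)$ let $S^1_h\subset(S^2,a\,\omega_{S^2})$ be the circle of constant height such that the annulus bounded by the equator and $S^1_h$ has signed area $h$. A *split torus* in $X_\alpha$ is a torus $T(x,y)=S^1_x\times S^1_y$ with $(x,y)\in(-1-\alpha,1+\alpha)\times(-\alpha,\alpha)$. Write $L\cong L'$ if $L'=\phi(L)$ for the time-one map $\phi$ of the flow of a smooth time-dependent Hamiltonian on $X_\alpha$. A *Weinstein neighbourhood* of a Lagrangian torus $L\subset X_\alpha$ is an open set $W\subset X_\alpha$ that is the image of an open neighbourhood of the zero section of $T^*L$ (with its canonical symplectic form) under a symplectic embedding that restricts to the inclusion $L\hookrightarrow X_\alpha$ on the zero section. Then for every $\alpha>0$ there is a split torus $L\subset X_\alpha$ such that every Weinstein neighbourhood of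 $L$ contains a split torus, and indeed infinitely many split tori, $L'$ with $L\cong L'$ and $L\cap L'=\varnothing$. -/

import Mathlib

open scoped Manifold ContDiff

noncomputable section

/-! ### The symplectic manifold `S² × S²` -/

/-- Euclidean three-space. -/
abbrev E3 : Type := EuclideanSpace ℝ (Fin 3)

/-- The unit sphere `S² ⊂ ℝ³`, with its standard smooth structure from Mathlib. -/
abbrev S2 : Type := Metric.sphere (0 : EuclideanSpace ℝ (Fin (2 + 1))) 1

/-- The smooth manifold underlying `X_α`. -/
abbrev S2xS2 : Type := S2 × S2

/-- The model with corners of `S² × S²`. -/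
abbrev modelX : ModelWithCorners ℝ
    (EuclideanSpace ℝ (Fin 2) × EuclideanSpace ℝ (Fin 2))
    (ModelProd (EuclideanSpace ℝ (Fin 2)) (EuclideanSpace ℝ (Fin 2))) :=
  (𝓡 2).prod (𝓡 2)

/-- The expression `det (p, u, v) / (4π)`. For `p` on the unit sphere and `u, v` tangent to the
sphere at `p`, this is the rotation invariant area form of total area `1`. -/
def ambientAreaForm (p u v : E3) : ℝ :=
  (Matrix.of ![(p : Fin 3 → ℝ), (u : Fin 3 → ℝ), (v : Fin 3 → ℝ)]).det / (4 * Real.pi)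

/-- The area form `ω_{S²}` on the sphere, of total area `1`: abstract tangent vectors are viewed
in `ℝ³` through the differential of the inclusion. -/
def sphereAreaForm (p : S2) (u v : TangentSpace (𝓡 2) p) : ℝ :=
  ambientAreaForm (p : E3)
    (mvfderiv (𝓡 2) (fun q : S2 => (q : E3)) p u)
    (mvfderiv (𝓡 2) (fun q : S2 => (q : E3)) p v)

/-- The symplectic form `ω_α = 2(α + 1) ω_{S²} ⊕ 2α ω_{S²}` on `S² × S²`. -/
def omega (α : ℝ) (p : S2xS2) (u v : TangentSpace modelX p) : ℝ :=
  2 * (α + 1) * sphereAreaForm p.1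
      (mfderiv modelX (𝓡 2) Prod.fst p u) (mfderiv modelX (𝓡 2) Prod.fst p v)
    + 2 * α * sphereAreaForm p.2
      (mfderiv modelX (𝓡 2) Prod.snd p u) (mfderiv modelX (𝓡 2) Prod.snd p v)

/-! ### Circles of constant height and split tori -/

/-- Cylindrical coordinates (angle, height) on the unit sphere. -/
def cylPoint (θ t : ℝ) : E3 :=
  !₂[Real.sqrt (1 - t ^ 2) * Real.cos θ, Real.sqrt (1 - t ^ 2) * Real.sin θ, t]

/-- The signed area, with respect to `a ω_{S²}`, of the annulus bounded by the equator and the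
circle at Euclidean height `z ∈ [-1, 1]`, as an integral in cylindrical coordinates. -/
def annulusArea (a z : ℝ) : ℝ :=
  ∫ t in (0 : ℝ)..z, ∫ θ in (0 : ℝ)..(2 * Real.pi),
    a * ambientAreaForm (cylPoint θ t)
      (deriv (fun s => cylPoint s t) θ) (deriv (fun s => cylPoint θ s) t)

/-- The circle `S¹_h` in `(S², a ω_{S²})`: the points at the constant height for which
the annulus between the equator and the circle has signed area `h`. -/
def heightCircle (a h : ℝ) : Set S2 :=
  {p | annulusArea a ((p : E3) 2) = h}

/-- The torus `T(x, y) = S¹_x × S¹_y ⊂ X_α`. -/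
def splitTorus (α x y : ℝ) : Set S2xS2 :=
  heightCircle (2 * (α + 1)) x ×ˢ heightCircle (2 * α) y

/-- Split tori in `X_α`. -/
def IsSplitTorus (α : ℝ) (L : Set S2xS2) : Prop :=
  ∃ x ∈ Set.Ioo (-1 - α) (1 + α), ∃ y ∈ Set.Ioo (-α) α, L = splitTorus α x y

/-! ### Hamiltonian isotopies -/

/-- `φ` is the Hamiltonian flow on `X_α` of the smooth time-dependent Hamiltonian `H`:
`φ_0 = id` and `ω_α (d/dt φ_t(p), ·) = dH_t` at `φ_t(p)`. -/
structure IsHamiltonianFlow (α : ℝ) (H : ℝ × S2xS2 → ℝ) (φ : ℝ → S2xS2 → S2xS2) : Prop where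
  smooth : ContMDiff (𝓘(ℝ, ℝ).prod modelX) 𝓘(ℝ, ℝ) ∞ H
  zero : ∀ p, φ 0 p = p
  differentiable : ∀ p, MDifferentiable 𝓘(ℝ, ℝ) modelX (fun t => φ t p)
  equation : ∀ (t : ℝ) (p : S2xS2) (v : TangentSpace modelX (φ t p)),
    omega α (φ t p) (mfderiv 𝓘(ℝ, ℝ) modelX (fun s => φ s p) t (1 : ℝ)) v
      = mvfderiv modelX (fun q => H (t, q)) (φ t p) v

/-- `L ≅ L'`: the subset `L` is mapped to `L'` by the time-one map of a Hamiltonian flow. -/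
def HamIsotopic (α : ℝ) (L L' : Set S2xS2) : Prop :=
  ∃ (H : ℝ × S2xS2 → ℝ) (φ : ℝ → S2xS2 → S2xS2), IsHamiltonianFlow α H φ ∧ φ 1 '' L = L'

/-! ### Weinstein neighbourhoods of tori -/

/-- The cotangent bundle `T*𝕋² = 𝕋² × ℝ²` of the two-torus, trivialised by the angular forms
`dq₁, dq₂`; the point `((z₁, z₂), (p₁, p₂))` is the covector `p₁ dq₁ + p₂ dq₂` at `(z₁, z₂)`. -/
abbrev CotangentT2 : Type := (Circle × Circle) × (ℝ × ℝ)

/-- The model with corners of `T*𝕋²`. -/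
abbrev modelT : ModelWithCorners ℝ
    ((EuclideanSpace ℝ (Fin 1) × EuclideanSpace ℝ (Fin 1)) × (ℝ × ℝ))
    (ModelProd (ModelProd (EuclideanSpace ℝ (Fin 1)) (EuclideanSpace ℝ (Fin 1))) (ℝ × ℝ)) :=
  ((𝓡 1).prod (𝓡 1)).prod 𝓘(ℝ, ℝ × ℝ)

/-- The angular form on the unit circle: on `d/dt (z e^{it})` it takes the value `1`. -/
def angularForm (z : Circle) (u : TangentSpace (𝓡 1) z) : ℝ :=
  ((starRingEnd ℂ) (z : ℂ) *
    mvfderiv (𝓡 1) (fun w : Circle => (w : ℂ)) z u).im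

/-- The form `dq₁` on `T*𝕋²`. -/
def dq₁ (c : CotangentT2) (u : TangentSpace modelT c) : ℝ :=
  angularForm c.1.1 (mfderiv modelT (𝓡 1) (fun b : CotangentT2 => b.1.1) c u)

/-- The form `dq₂` on `T*𝕋²`. -/
def dq₂ (c : CotangentT2) (u : TangentSpace modelT c) : ℝ :=
  angularForm c.1.2 (mfderiv modelT (𝓡 1) (fun b : CotangentT2 => b.1.2) c u)

/-- The form `dp₁` on `T*𝕋²`. -/
def dp₁ (c : CotangentT2) (u : TangentSpace modelT c) : ℝ :=
  mvfderiv modelT (fun b : CotangentT2 => b.2.1) c u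

/-- The form `dp₂` on `T*𝕋²`. -/
def dp₂ (c : CotangentT2) (u : TangentSpace modelT c) : ℝ :=
  mvfderiv modelT (fun b : CotangentT2 => b.2.2) c u

/-- The canonical symplectic form `dp₁ ∧ dq₁ + dp₂ ∧ dq₂` on `T*𝕋²`. -/
def canonicalForm (c : CotangentT2) (u v : TangentSpace modelT c) : ℝ :=
  (dp₁ c u * dq₁ c v - dp₁ c v * dq₁ c u) + (dp₂ c u * dq₂ c v - dp₂ c v * dq₂ c u)

/-- The zero section of `T*𝕋²`. -/
def zeroSection : Set CotangentT2 := {c | c.2 = 0}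

/-- `W` is a Weinstein neighbourhood of the Lagrangian torus `L ⊂ X_α`: an open set that is the
image of an open neighbourhood `V` of the zero section under a symplectic embedding `Ψ` that maps
the zero section onto `L`. (The restriction of `Ψ` to the zero section is a diffeomorphism
`𝕋² → L`, and it induces the identification of `T*L` with `T*𝕋²`. The inverse of `Ψ` is smooth
since the differentials of `Ψ` preserve symplectic forms of the same dimension.) -/
def IsWeinsteinNhd (α : ℝ) (L W : Set S2xS2) : Prop :=
  ∃ (V : Set CotangentT2) (Ψ : CotangentT2 → S2xS2),
    IsOpen V ∧ zeroSection ⊆ V ∧ ContMDiffOn modelT modelX ∞ Ψ V ∧ Set.InjOn Ψ V ∧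
    (∀ c ∈ V, ∀ u v : TangentSpace modelT c,
      omega α (Ψ c) (mfderiv modelT modelX Ψ c u) (mfderiv modelT modelX Ψ c v)
        = canonicalForm c u v) ∧
    Ψ '' zeroSection = L ∧ Ψ '' V = W ∧ IsOpen W

/-! ### The circles `S¹_h` in terms of Euclidean height -/

theorem hasDerivAt_E3 {f : ℝ → E3} {v : E3} {t : ℝ}
    (h : ∀ i, HasDerivAt (fun s => f s i) (v i) t) : HasDerivAt f v t :=
  (PiLp.continuousLinearEquiv 2 ℝ (fun _ : Fin 3 => ℝ)).symm.hasFDerivAt.comp_hasDerivAt t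
    (hasDerivAt_pi.2 h)

theorem ambientAreaForm_cyl {t : ℝ} (ht : t ∈ Set.Ioo (-1 : ℝ) 1) (θ : ℝ) :
    ambientAreaForm (cylPoint θ t)
      (deriv (fun s => cylPoint s t) θ) (deriv (fun s => cylPoint θ s) t)
      = 1 / (4 * Real.pi) := by
  have hpos : 0 < 1 - t ^ 2 := by nlinarith [ht.1, ht.2]
  have h1 : HasDerivAt (fun s => cylPoint s t)
      !₂[Real.sqrt (1 - t ^ 2) * (-Real.sin θ), Real.sqrt (1 - t ^ 2) * Real.cos θ, 0] θ := by
    refine hasDerivAt_E3 fun i => ?_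
    fin_cases i
    · simpa [cylPoint] using (Real.hasDerivAt_cos θ).const_mul (Real.sqrt (1 - t ^ 2))
    · simpa [cylPoint] using (Real.hasDerivAt_sin θ).const_mul (Real.sqrt (1 - t ^ 2))
    · simpa [cylPoint] using hasDerivAt_const θ t
  obtain ⟨r, hr⟩ : ∃ r, HasDerivAt (fun s : ℝ => Real.sqrt (1 - s ^ 2)) r t ∧
      r * Real.sqrt (1 - t ^ 2) = -t := by
    have h := ((hasDerivAt_pow 2 t).const_sub 1).sqrt hpos.ne'
    refine ⟨_, h, ?_⟩
    have : Real.sqrt (1 - t ^ 2) ≠ 0 := (Real.sqrt_pos.2 hpos).ne'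
    field_simp
    simp
  have h2 : HasDerivAt (fun s => cylPoint θ s)
      !₂[r * Real.cos θ, r * Real.sin θ, 1] t := by
    refine hasDerivAt_E3 fun i => ?_
    fin_cases i
    · simpa [cylPoint] using hr.1.mul_const (Real.cos θ)
    · simpa [cylPoint] using hr.1.mul_const (Real.sin θ)
    · simpa [cylPoint] using hasDerivAt_id' t
  have hs : Real.sqrt (1 - t ^ 2) ^ 2 = 1 - t ^ 2 := Real.sq_sqrt hpos.le
  have hc : Real.sin θ ^ 2 = 1 - Real.cos θ ^ 2 := by
    linarith [Real.sin_sq_add_cos_sq θ]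
  rw [h1.deriv, h2.deriv, ambientAreaForm, Matrix.det_fin_three]
  congr 1
  simp [cylPoint]
  linear_combination (hs - t * hr.2) + (Real.sqrt (1 - t ^ 2) ^ 2 - t * (r * Real.sqrt (1 - t ^ 2))) * hc

theorem annulusArea_eq (a : ℝ) {z : ℝ} (hz : z ∈ Set.Icc (-1 : ℝ) 1) :
    annulusArea a z = a * z / 2 := by
  have : annulusArea a z = ∫ _t in (0 : ℝ)..z, a / 2 := by
    refine intervalIntegral.integral_congr_ae ?_
    have h0 : ∀ᵐ t : ℝ, t ≠ 1 := MeasureTheory.Measure.ae_ne MeasureTheory.volume 1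
    have h0' : ∀ᵐ t : ℝ, t ≠ -1 := MeasureTheory.Measure.ae_ne MeasureTheory.volume (-1)
    filter_upwards [h0, h0'] with t h1 h1' ht
    have ht' : t ∈ Set.Ioo (-1 : ℝ) 1 := by
      rw [Set.mem_uIoc] at ht
      rcases ht with ht | ht
      · exact ⟨by linarith, lt_of_le_of_ne (ht.2.trans hz.2) h1⟩
      · exact ⟨hz.1.trans_lt ht.1, by linarith⟩
    simp only [ambientAreaForm_cyl ht']
    rw [intervalIntegral.integral_const, smul_eq_mul]
    have := Real.pi_ne_zero
    field_simp
    ring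
  rw [this, intervalIntegral.integral_const, smul_eq_mul]
  ring

/-- The circle `S¹_h` in `(S², a ω_{S²})` lies at Euclidean height `2h/a`. -/
theorem mem_heightCircle_iff {a : ℝ} (ha : a ≠ 0) (h : ℝ) (p : S2) :
    p ∈ heightCircle a h ↔ (p : E3) 2 = 2 * h / a := by
  have hp : ((p : E3) 2) ∈ Set.Icc (-1 : ℝ) 1 := by
    have h1 : |(p : E3) 2| ≤ ‖(p : E3)‖ := by
      simpa using PiLp.norm_apply_le (p : E3) 2
    have h2 : ‖(p : E3)‖ = 1 := by simp
    rw [h2] at h1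
    exact abs_le.1 h1
  change annulusArea a ((p : E3) 2) = h ↔ _
  rw [annulusArea_eq a hp]
  rw [eq_div_iff ha]
  constructor <;> intro h <;> linarith

end

noncomputable section

/-! ### Hamiltonian flows from ambient data -/

/-! The coordinates `(x, y) = ((α + 1) z₁, α z₂)` form a moment map onto a rectangle, and split tori
are its fibres over the interior. The Hamiltonian isotopies come from symmetric probes, that is,
from the segments `x - y = μ`. Reduction by the circle action with moment map `x - y` turns such a
level into a sphere on which split tori become circles of latitude. A half turn of this sphere
exchanges the two circles symmetric about the equator. It lifts to the time-one map of a Hamiltonian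
flow, and a cut-off in `μ` makes the flow global.

For `|μ| < 1` the probe joins the facets `y = ±α` and yields `(x, y) ↦ (x - 2y, -y)`
(`hamIsotopic_shear`). For `μ > 1` it joins `y = -α` to `x = 1 + α` and yields `(x, y) ↦ (1 - y, 1 -
x)` (`hamIsotopic_corner`). Half turns of the two factors give `(x, y) ↦ (±x, ±y)`.

Fix `y > 0`. Shears and sign changes translate `x` by `2y` inside `(-1 - y, 1 + y)`. Two corner
moves reflect `1 + s` to `1 - s` when `|s| < y` (`hamIsotopic_reflect`). With the reflection at `0`
this gives translations of `s` by `2`. For irrational `y`, every `1 + s` with `s ∈ 2ℤ + 2yℤ` and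
`|s| < y` is therefore reached from `1` (`hamIsotopic_orbit`). This group is dense, so infinitely
many such `s` are positive and arbitrarily small. The corresponding tori are disjoint from `L = T(1,
y)`, and by compactness they lie in any given open set around it (`exists_splitTorus_subset`). -/

instance fact_finrank_E3 : Fact (Module.finrank ℝ (EuclideanSpace ℝ (Fin (2 + 1))) = 2 + 1) :=
  ⟨finrank_euclideanSpace_fin⟩

theorem mdifferentiableAt_coe_S2 (q : S2) :
    MDifferentiableAt (𝓡 2) 𝓘(ℝ, E3) (fun q : S2 => (q : E3)) q :=
  (contMDiff_coe_sphere (m := 1) q).mdifferentiableAt one_ne_zero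

theorem contMDiff_sphere_curve {c : ℝ → S2} (hc : ContDiff ℝ ∞ (fun t => (c t : E3))) :
    ContMDiff 𝓘(ℝ, ℝ) (𝓡 2) ∞ c :=
  ContMDiff.codRestrict_sphere hc.contMDiff fun t => (c t).2

/-- This turns the intrinsic velocity in Hamilton's equation into an ordinary derivative in `ℝ³`. -/
theorem mvfderiv_coe_mfderiv_curve {c : ℝ → S2} (hc : ContDiff ℝ ∞ (fun t => (c t : E3))) (t : ℝ) :
    mvfderiv (𝓡 2) (fun q : S2 => (q : E3)) (c t) (mfderiv 𝓘(ℝ, ℝ) (𝓡 2) c t (1 : ℝ))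
      = deriv (fun s => (c s : E3)) t := by
  have hd : MDifferentiableAt 𝓘(ℝ, ℝ) (𝓡 2) c t :=
    (contMDiff_sphere_curve hc t).mdifferentiableAt (by simp)
  have h := mfderiv_comp_apply (I' := 𝓡 2) t (mdifferentiableAt_coe_S2 (c t)) hd (1 : ℝ)
  refine h.symm.trans ?_
  change mfderiv 𝓘(ℝ, ℝ) 𝓘(ℝ, E3) (fun s => (c s : E3)) t (1 : ℝ) = _
  rw [mfderiv_eq_fderiv]
  change (fderiv ℝ (fun s => (c s : E3)) t : ℝ →L[ℝ] E3) (1 : ℝ) = _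
  exact fderiv_apply_one_eq_deriv

theorem inner_mvfderiv_coe (q : S2) (u : TangentSpace (𝓡 2) q) :
    inner ℝ (q : E3) (mvfderiv (𝓡 2) (fun q : S2 => (q : E3)) q u) = 0 := by
  have h : mvfderiv (𝓡 2) (fun q : S2 => (q : E3)) q u ∈
      (mvfderiv (𝓡 2) ((↑) : S2 → E3) q).range := ⟨u, rfl⟩
  rw [range_mvfderiv_subtypeVal] at h
  exact (Submodule.mem_orthogonal_singleton_iff_inner_right).1 h

/-- The inclusion of `S² × S²` into `ℝ³ × ℝ³`. -/
def inclX (q : S2xS2) : E3 × E3 := (q.1, q.2)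

theorem contMDiff_inclX : ContMDiff modelX 𝓘(ℝ, E3 × E3) ∞ inclX := by
  have h1 : ContMDiff modelX 𝓘(ℝ, E3) ∞ (fun q : S2xS2 => (q.1 : E3)) :=
    contMDiff_coe_sphere.comp contMDiff_fst
  have h2 : ContMDiff modelX 𝓘(ℝ, E3) ∞ (fun q : S2xS2 => (q.2 : E3)) :=
    contMDiff_coe_sphere.comp contMDiff_snd
  exact h1.prodMk_space h2

/-- Each component is differentiated twice by the chain rule, once through a factor of `S² × S²` and
once through `inclX`; the two results are compared. -/
theorem mfderiv_inclX (q : S2xS2) (v : TangentSpace modelX q) :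
    mfderiv modelX 𝓘(ℝ, E3 × E3) inclX q v =
      ((mvfderiv (𝓡 2) (fun q : S2 => (q : E3)) q.1 (mfderiv modelX (𝓡 2) Prod.fst q v),
        mvfderiv (𝓡 2) (fun q : S2 => (q : E3)) q.2 (mfderiv modelX (𝓡 2) Prod.snd q v)) :
          E3 × E3) := by
  have hι : MDifferentiableAt modelX 𝓘(ℝ, E3 × E3) inclX q :=
    (contMDiff_inclX q).mdifferentiableAt (by simp)
  have f1 : mfderiv modelX 𝓘(ℝ, E3) (fun q : S2xS2 => (q.1 : E3)) q v
      = mfderiv (𝓡 2) 𝓘(ℝ, E3) (fun q : S2 => (q : E3)) q.1 (mfderiv modelX (𝓡 2) Prod.fst q v) :=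
    mfderiv_comp_apply (I' := 𝓡 2) q (mdifferentiableAt_coe_S2 q.1) mdifferentiableAt_fst v
  have f2 : mfderiv modelX 𝓘(ℝ, E3) (fun q : S2xS2 => (q.2 : E3)) q v
      = mfderiv (𝓡 2) 𝓘(ℝ, E3) (fun q : S2 => (q : E3)) q.2 (mfderiv modelX (𝓡 2) Prod.snd q v) :=
    mfderiv_comp_apply (I' := 𝓡 2) q (mdifferentiableAt_coe_S2 q.2) mdifferentiableAt_snd v
  have g1 : mfderiv modelX 𝓘(ℝ, E3) (fun q : S2xS2 => (q.1 : E3)) q v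
      = mfderiv 𝓘(ℝ, E3 × E3) 𝓘(ℝ, E3) Prod.fst (inclX q)
          (mfderiv modelX 𝓘(ℝ, E3 × E3) inclX q v) :=
    mfderiv_comp_apply (I' := 𝓘(ℝ, E3 × E3)) q
      (differentiableAt_fst (𝕜 := ℝ) (E := E3) (F := E3)).mdifferentiableAt hι v
  have g2 : mfderiv modelX 𝓘(ℝ, E3) (fun q : S2xS2 => (q.2 : E3)) q v
      = mfderiv 𝓘(ℝ, E3 × E3) 𝓘(ℝ, E3) Prod.snd (inclX q)
          (mfderiv modelX 𝓘(ℝ, E3 × E3) inclX q v) :=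
    mfderiv_comp_apply (I' := 𝓘(ℝ, E3 × E3)) q
      (differentiableAt_snd (𝕜 := ℝ) (E := E3) (F := E3)).mdifferentiableAt hι v
  rw [mfderiv_eq_fderiv, fderiv_fst] at g1
  rw [mfderiv_eq_fderiv, fderiv_snd] at g2
  exact Prod.ext (g1.symm.trans f1) (g2.symm.trans f2)

/-- A function on `ℝ³ × ℝ³` that is smooth along `S² × S²` is an autonomous Hamiltonian there. It
generates `φ` as soon as Hamilton's equation holds for tangent vectors of `S² × S²` in `ℝ³ × ℝ³`. -/
theorem isHamiltonianFlow_of_ambient {α : ℝ} {F : E3 × E3 → ℝ} {φ : ℝ → S2xS2 → S2xS2}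
    (hF : ∀ q, ContDiffAt ℝ ∞ F (inclX q)) (h0 : ∀ p, φ 0 p = p)
    (h1 : ∀ p, ContDiff ℝ ∞ (fun t => ((φ t p).1 : E3)))
    (h2 : ∀ p, ContDiff ℝ ∞ (fun t => ((φ t p).2 : E3)))
    (heq : ∀ t p, ∀ v₁ v₂ : E3, inner ℝ ((φ t p).1 : E3) v₁ = 0 → inner ℝ ((φ t p).2 : E3) v₂ = 0 →
      2 * (α + 1) * ambientAreaForm (φ t p).1 (deriv (fun s => ((φ s p).1 : E3)) t) v₁
        + 2 * α * ambientAreaForm (φ t p).2 (deriv (fun s => ((φ s p).2 : E3)) t) v₂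
        = fderiv ℝ F (inclX (φ t p)) (v₁, v₂)) :
    IsHamiltonianFlow α (fun q => F (inclX q.2)) φ := by
  have hc : ∀ p, ContMDiff 𝓘(ℝ, ℝ) modelX ∞ (fun t => φ t p) := fun p =>
    (contMDiff_sphere_curve (h1 p)).prodMk (contMDiff_sphere_curve (h2 p))
  have hd : ∀ p, MDifferentiable 𝓘(ℝ, ℝ) modelX (fun t => φ t p) := fun p =>
    (hc p).mdifferentiable (by simp)
  refine ⟨?_, h0, hd, ?_⟩
  · intro q
    exact (hF q.2).contMDiffAt.comp q ((contMDiff_inclX.comp contMDiff_snd) q)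
  · intro t p v
    have hι : MDifferentiableAt modelX 𝓘(ℝ, E3 × E3) inclX (φ t p) :=
      (contMDiff_inclX (φ t p)).mdifferentiableAt (by simp)
    have hFd : MDifferentiableAt 𝓘(ℝ, E3 × E3) 𝓘(ℝ, ℝ) F (inclX (φ t p)) :=
      ((hF (φ t p)).differentiableAt (by simp)).mdifferentiableAt
    have hr := mvfderiv_comp_apply (I := 𝓘(ℝ, E3 × E3)) (I' := modelX) (φ t p) hFd hι v
    have hr' : mvfderiv modelX (fun q => F (inclX q)) (φ t p) v
        = fderiv ℝ F (inclX (φ t p)) (mfderiv modelX 𝓘(ℝ, E3 × E3) inclX (φ t p) v) := by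
      rw [← mfderiv_eq_fderiv]
      exact hr
    rw [hr', mfderiv_inclX, ← heq t p _ _ (inner_mvfderiv_coe _ _) (inner_mvfderiv_coe _ _)]
    unfold omega sphereAreaForm
    have e1 : mfderiv modelX (𝓡 2) Prod.fst (φ t p)
        (mfderiv 𝓘(ℝ, ℝ) modelX (fun s => φ s p) t (1 : ℝ))
        = mfderiv 𝓘(ℝ, ℝ) (𝓡 2) (fun s => (φ s p).1) t (1 : ℝ) :=
      (mfderiv_comp_apply (I' := modelX) t mdifferentiableAt_fst (hd p t) (1 : ℝ)).symm
    have e2 : mfderiv modelX (𝓡 2) Prod.snd (φ t p)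
        (mfderiv 𝓘(ℝ, ℝ) modelX (fun s => φ s p) t (1 : ℝ))
        = mfderiv 𝓘(ℝ, ℝ) (𝓡 2) (fun s => (φ s p).2) t (1 : ℝ) :=
      (mfderiv_comp_apply (I' := modelX) t mdifferentiableAt_snd (hd p t) (1 : ℝ)).symm
    rw [e1, e2]
    have f1 := mvfderiv_coe_mfderiv_curve (c := fun s => (φ s p).1) (h1 p) t
    have f2 := mvfderiv_coe_mfderiv_curve (c := fun s => (φ s p).2) (h2 p) t
    rw [f1, f2]

/-! ### Hamiltonian isotopy is reflexive and transitive -/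

theorem sphereAreaForm_smul_left (p : S2) (c : ℝ) (u v : TangentSpace (𝓡 2) p) :
    sphereAreaForm p (c • u) v = c * sphereAreaForm p u v := by
  simp only [sphereAreaForm, ambientAreaForm, Matrix.det_fin_three, map_smul]
  simp
  ring

theorem omega_smul_left (α : ℝ) (p : S2xS2) (c : ℝ) (u v : TangentSpace modelX p) :
    omega α p (c • u) v = c * omega α p u v := by
  have e1 : mfderiv modelX (𝓡 2) Prod.fst p (c • u) = c • mfderiv modelX (𝓡 2) Prod.fst p u :=
    map_smul _ _ _
  have e2 : mfderiv modelX (𝓡 2) Prod.snd p (c • u) = c • mfderiv modelX (𝓡 2) Prod.snd p u :=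
    map_smul _ _ _
  unfold omega
  rw [e1, e2, sphereAreaForm_smul_left, sphereAreaForm_smul_left]
  ring

theorem omega_zero_left (α : ℝ) (p : S2xS2) (v : TangentSpace modelX p) : omega α p 0 v = 0 := by
  have h := omega_smul_left α p 0 0 v
  rwa [zero_smul, zero_mul] at h

theorem HamIsotopic.refl (α : ℝ) (L : Set S2xS2) : HamIsotopic α L L := by
  refine ⟨fun _ => 0, fun _ p => p, ⟨contMDiff_const, fun _ => rfl,
    fun _ => mdifferentiable_const, fun t p v => ?_⟩, by simp⟩
  rw [mfderiv_const]
  simp only [mvfderiv_const]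
  exact omega_zero_left α p v

/-- Hamilton's equation for a flow that is run at a variable speed. -/
theorem IsHamiltonianFlow.comp_time {α : ℝ} {H : ℝ × S2xS2 → ℝ} {φ : ℝ → S2xS2 → S2xS2}
    (h : IsHamiltonianFlow α H φ) {ρ : ℝ → ℝ} {t r : ℝ} (hρ : HasDerivAt ρ r t) (p : S2xS2) :
    MDifferentiableAt 𝓘(ℝ, ℝ) modelX (fun s => φ (ρ s) p) t ∧
      ∀ v : TangentSpace modelX (φ (ρ t) p),
        omega α (φ (ρ t) p) (mfderiv 𝓘(ℝ, ℝ) modelX (fun s => φ (ρ s) p) t (1 : ℝ)) v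
          = r * mvfderiv modelX (fun q => H (ρ t, q)) (φ (ρ t) p) v := by
  have hρm : MDifferentiableAt 𝓘(ℝ, ℝ) 𝓘(ℝ, ℝ) ρ t := hρ.differentiableAt.mdifferentiableAt
  have hφ := h.differentiable p (ρ t)
  refine ⟨hφ.comp t hρm, fun v => ?_⟩
  have e1 : mfderiv 𝓘(ℝ, ℝ) modelX (fun s => φ (ρ s) p) t (1 : ℝ)
      = mfderiv 𝓘(ℝ, ℝ) modelX (fun s => φ s p) (ρ t) (mfderiv 𝓘(ℝ, ℝ) 𝓘(ℝ, ℝ) ρ t (1 : ℝ)) :=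
    mfderiv_comp_apply (I' := 𝓘(ℝ, ℝ)) t hφ hρm (1 : ℝ)
  have e2 : mfderiv 𝓘(ℝ, ℝ) 𝓘(ℝ, ℝ) ρ t (1 : ℝ) = r • (1 : ℝ) := by
    rw [mfderiv_eq_fderiv]
    change (fderiv ℝ ρ t : ℝ →L[ℝ] ℝ) (1 : ℝ) = r • (1 : ℝ)
    rw [fderiv_apply_one_eq_deriv, hρ.deriv, smul_eq_mul, mul_one]
  have e3 : mfderiv 𝓘(ℝ, ℝ) modelX (fun s => φ s p) (ρ t) (r • (1 : ℝ))
      = r • mfderiv 𝓘(ℝ, ℝ) modelX (fun s => φ s p) (ρ t) (1 : ℝ) :=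
    (mfderiv 𝓘(ℝ, ℝ) modelX (fun s => φ s p) (ρ t)).map_smul r (1 : ℝ)
  rw [e1, e2, e3, omega_smul_left, h.equation]

/-- The flows are run one after the other with smooth clocks: `σ` moves on `[0, 1/3]`, `τ` on `[2/3,
1]`. Near each time at most one clock moves, so the generator is the sum `σ' H + τ' K` and no
Hamiltonian has to be transported by a flow. -/
theorem HamIsotopic.trans {α : ℝ} {L₁ L₂ L₃ : Set S2xS2} (h₁ : HamIsotopic α L₁ L₂)
    (h₂ : HamIsotopic α L₂ L₃) : HamIsotopic α L₁ L₃ := by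
  obtain ⟨H, φ, hφ, rfl⟩ := h₁
  obtain ⟨K, ψ, hψ, rfl⟩ := h₂
  set σ : ℝ → ℝ := fun t => Real.smoothTransition (3 * t) with hσ
  set τ : ℝ → ℝ := fun t => Real.smoothTransition (3 * t - 2) with hτ
  have hσs : ContDiff ℝ ∞ σ :=
    Real.smoothTransition.contDiff.comp (contDiff_const.mul contDiff_id)
  have hτs : ContDiff ℝ ∞ τ :=
    Real.smoothTransition.contDiff.comp ((contDiff_const.mul contDiff_id).sub contDiff_const)
  have hσ1 : ∀ t, 1 / 3 ≤ t → σ t = 1 := fun t ht =>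
    Real.smoothTransition.one_of_one_le (by linarith)
  have hτ0 : ∀ t, t ≤ 2 / 3 → τ t = 0 := fun t ht =>
    Real.smoothTransition.zero_of_nonpos (by linarith)
  have hσd : ∀ t, HasDerivAt σ (deriv σ t) t := fun t =>
    (hσs.differentiable (by simp) t).hasDerivAt
  have hτd : ∀ t, HasDerivAt τ (deriv τ t) t := fun t =>
    (hτs.differentiable (by simp) t).hasDerivAt
  have key : ∀ t p, MDifferentiableAt 𝓘(ℝ, ℝ) modelX (fun s => ψ (τ s) (φ (σ s) p)) t ∧
      ∀ v : TangentSpace modelX (ψ (τ t) (φ (σ t) p)),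
        omega α (ψ (τ t) (φ (σ t) p))
          (mfderiv 𝓘(ℝ, ℝ) modelX (fun s => ψ (τ s) (φ (σ s) p)) t (1 : ℝ)) v
          = mvfderiv modelX (fun q => deriv σ t * H (σ t, q) + deriv τ t * K (τ t, q))
              (ψ (τ t) (φ (σ t) p)) v := by
    intro t p
    have hHd : ∀ s q, MDifferentiableAt modelX 𝓘(ℝ, ℝ) (fun q => H (s, q)) q := fun s q =>
      ((hφ.smooth.comp (contMDiff_const.prodMk contMDiff_id)) q).mdifferentiableAt (by simp)
    have hKd : ∀ s q, MDifferentiableAt modelX 𝓘(ℝ, ℝ) (fun q => K (s, q)) q := fun s q =>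
      ((hψ.smooth.comp (contMDiff_const.prodMk contMDiff_id)) q).mdifferentiableAt (by simp)
    have hmul : ∀ (c : ℝ) (f : S2xS2 → ℝ) (q : S2xS2) (v : TangentSpace modelX q),
        MDifferentiableAt modelX 𝓘(ℝ, ℝ) f q →
        mvfderiv modelX (fun q => c * f q) q v = c * mvfderiv modelX f q v := by
      intro c f q v hf
      exact congrArg (fun T => T v) (const_smul_mfderiv hf c)
    -- The cut lies at the end of the pause: for `t < 2/3` the clock `τ` is locally `0`, and for `t
    -- ≥ 2/3` the clock `σ` is locally `1`.
    rcases lt_or_ge t (2 / 3) with ht | ht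
    · have hev : ∀ᶠ s in nhds t, τ s = 0 :=
        (eventually_lt_nhds ht).mono fun s hs => hτ0 s hs.le
      have hd0 : deriv τ t = 0 := by
        rw [Filter.EventuallyEq.deriv_eq (f := fun _ => (0 : ℝ)) hev]; simp
      have hev' : (fun s => ψ (τ s) (φ (σ s) p)) =ᶠ[nhds t] (fun s => φ (σ s) p) :=
        hev.mono fun s hs => by simp only [hs, hψ.zero]
      have hc := hφ.comp_time (hσd t) p
      have hpt : ψ (τ t) (φ (σ t) p) = φ (σ t) p := hev'.eq_of_nhds
      refine ⟨hc.1.congr_of_eventuallyEq hev', ?_⟩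
      rw [hev'.mfderiv_eq, hpt]
      intro v
      refine (hc.2 v).trans ?_
      simp only [hd0, zero_mul, add_zero]
      exact (hmul _ _ _ _ (hHd _ _)).symm
    · have hev : ∀ᶠ s in nhds t, σ s = 1 :=
        (eventually_gt_nhds (show 1 / 3 < t by linarith)).mono fun s hs => hσ1 s hs.le
      have hd0 : deriv σ t = 0 := by
        rw [Filter.EventuallyEq.deriv_eq (f := fun _ => (1 : ℝ)) hev]; simp
      have hev' : (fun s => ψ (τ s) (φ (σ s) p)) =ᶠ[nhds t] (fun s => ψ (τ s) (φ 1 p)) :=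
        hev.mono fun s hs => by simp only [hs]
      have hc := hψ.comp_time (hτd t) (φ 1 p)
      have hpt : ψ (τ t) (φ (σ t) p) = ψ (τ t) (φ 1 p) := hev'.eq_of_nhds
      refine ⟨hc.1.congr_of_eventuallyEq hev', ?_⟩
      rw [hev'.mfderiv_eq, hpt]
      intro v
      refine (hc.2 v).trans ?_
      simp only [hd0, zero_mul, zero_add]
      exact (hmul _ _ _ _ (hKd _ _)).symm
  refine ⟨fun q => deriv σ q.1 * H (σ q.1, q.2) + deriv τ q.1 * K (τ q.1, q.2),
    fun t p => ψ (τ t) (φ (σ t) p), ⟨?_, ?_, fun p t => (key t p).1, fun t p => (key t p).2⟩, ?_⟩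
  · have hd : ∀ ρ : ℝ → ℝ, ContDiff ℝ ∞ ρ →
        ContMDiff (𝓘(ℝ, ℝ).prod modelX) 𝓘(ℝ, ℝ) ∞ (fun q : ℝ × S2xS2 => ρ q.1) := fun ρ hρ =>
      hρ.contMDiff.comp contMDiff_fst
    have hds : ∀ ρ : ℝ → ℝ, ContDiff ℝ ∞ ρ → ContDiff ℝ ∞ (deriv ρ) := fun ρ hρ =>
      (contDiff_infty_iff_deriv.1 hρ).2
    exact ((hd _ (hds σ hσs)).mul (hφ.smooth.comp ((hd σ hσs).prodMk contMDiff_snd))).add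
      ((hd _ (hds τ hτs)).mul (hψ.smooth.comp ((hd τ hτs).prodMk contMDiff_snd)))
  · intro p
    have e1 : σ 0 = 0 := by simp [hσ]
    have e2 : τ 0 = 0 := hτ0 0 (by norm_num)
    simp only [e1, e2, hφ.zero, hψ.zero]
  · have e1 : σ 1 = 1 := hσ1 1 (by norm_num)
    have e2 : τ 1 = 1 := Real.smoothTransition.one_of_one_le (by norm_num)
    simp only [e1, e2, Set.image_image]

/-! ### Cylindrical coordinates on the sphere -/

/-- The horizontal coordinates of a point of the sphere, as a complex number. -/
def zeta (p : S2) : ℂ := ⟨(p : E3) 0, (p : E3) 1⟩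

/-- The vertical coordinate of a point of the sphere. -/
def height (p : S2) : ℝ := (p : E3) 2

theorem sphere_eq (p : S2) : ((p : E3) 0) ^ 2 + ((p : E3) 1) ^ 2 + ((p : E3) 2) ^ 2 = 1 := by
  have h : ‖(p : E3)‖ ^ 2 = 1 := by simp
  rw [EuclideanSpace.real_norm_sq_eq, Fin.sum_univ_three] at h
  exact h

theorem normSq_zeta (p : S2) : Complex.normSq (zeta p) = 1 - height p ^ 2 := by
  have := sphere_eq p
  simp only [Complex.normSq_apply, zeta, height]
  linarith

theorem height_mem (p : S2) : height p ∈ Set.Icc (-1 : ℝ) 1 := by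
  have h1 := normSq_zeta p
  have h2 := Complex.normSq_nonneg (zeta p)
  exact abs_le.1 ((sq_le_one_iff_abs_le_one _).1 (by linarith))

theorem S2_ext {p q : S2} (h1 : zeta p = zeta q) (h2 : height p = height q) : p = q := by
  apply Subtype.ext
  ext i
  have h3 := congrArg Complex.re h1
  have h4 := congrArg Complex.im h1
  fin_cases i
  · exact h3
  · exact h4
  · exact h2

/-- The point of the sphere with given horizontal and vertical coordinates. -/
def spherePoint (ζ : ℂ) (z : ℝ) (h : Complex.normSq ζ + z ^ 2 = 1) : S2 :=
  ⟨!₂[ζ.re, ζ.im, z], by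
    rw [mem_sphere_zero_iff_norm, ← sq_eq_sq₀ (norm_nonneg _) zero_le_one,
      EuclideanSpace.real_norm_sq_eq, Fin.sum_univ_three, one_pow, ← h, Complex.normSq_apply]
    simp
    ring⟩

@[simp] theorem zeta_spherePoint {ζ : ℂ} {z : ℝ} (h) : zeta (spherePoint ζ z h) = ζ := rfl

@[simp] theorem height_spherePoint {ζ : ℂ} {z : ℝ} (h) : height (spherePoint ζ z h) = z := rfl

theorem contDiff_coe_of_coords {c : ℝ → S2} (h1 : ContDiff ℝ ∞ fun t => zeta (c t))
    (h2 : ContDiff ℝ ∞ fun t => height (c t)) : ContDiff ℝ ∞ fun t => (c t : E3) := by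
  rw [contDiff_euclidean]
  intro i
  fin_cases i
  · exact Complex.reCLM.contDiff.comp h1
  · exact Complex.imCLM.contDiff.comp h1
  · exact h2

theorem hasDerivAt_coe_of_coords {c : ℝ → S2} {d : ℂ} {e t : ℝ}
    (h1 : HasDerivAt (fun t => zeta (c t)) d t) (h2 : HasDerivAt (fun t => height (c t)) e t) :
    HasDerivAt (fun t => (c t : E3)) !₂[d.re, d.im, e] t := by
  refine hasDerivAt_E3 fun i => ?_
  fin_cases i
  · exact Complex.reCLM.hasFDerivAt.comp_hasDerivAt t h1
  · exact Complex.imCLM.hasFDerivAt.comp_hasDerivAt t h1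
  · exact h2

/-! ### Hamiltonians of the form `h(z₁, z₂) Re (ζ₁ ζ₂)` -/

/-- The Hamilton equations of `h(z₁, z₂) Re (ζ₁ ζ₂) / 2π` along a curve in `X_α`. -/
structure IsProbeCurve (α : ℝ) (h : ℝ × ℝ → ℝ) (c : ℝ → S2xS2) : Prop where
  zeta₁ : ContDiff ℝ ∞ fun t => zeta (c t).1
  zeta₂ : ContDiff ℝ ∞ fun t => zeta (c t).2
  height₁ : ContDiff ℝ ∞ fun t => height (c t).1
  height₂ : ContDiff ℝ ∞ fun t => height (c t).2
  equation : ∀ t, ∃ (d₁ d₂ : ℂ) (e₁ e₂ : ℝ),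
    HasDerivAt (fun t => zeta (c t).1) d₁ t ∧ HasDerivAt (fun t => zeta (c t).2) d₂ t ∧
    HasDerivAt (fun t => height (c t).1) e₁ t ∧ HasDerivAt (fun t => height (c t).2) e₂ t ∧
    ((α + 1 : ℝ) : ℂ) * d₁ = Complex.I *
      (((zeta (c t).1 * zeta (c t).2).re
          * fderiv ℝ h (height (c t).1, height (c t).2) (1, 0) : ℝ) * zeta (c t).1
        - (h (height (c t).1, height (c t).2) * height (c t).1 : ℝ)
          * (starRingEnd ℂ) (zeta (c t).2)) ∧
    (α : ℂ) * d₂ = Complex.I *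
      (((zeta (c t).1 * zeta (c t).2).re
          * fderiv ℝ h (height (c t).1, height (c t).2) (0, 1) : ℝ) * zeta (c t).2
        - (h (height (c t).1, height (c t).2) * height (c t).2 : ℝ)
          * (starRingEnd ℂ) (zeta (c t).1)) ∧
    (α + 1) * e₁ = h (height (c t).1, height (c t).2) * (zeta (c t).1 * zeta (c t).2).im ∧
    α * e₂ = h (height (c t).1, height (c t).2) * (zeta (c t).1 * zeta (c t).2).im

/-- The ambient function `h(z₁, z₂) Re (ζ₁ ζ₂) / 2π`. -/
def probeHamiltonian (h : ℝ × ℝ → ℝ) (x : E3 × E3) : ℝ :=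
  h (x.1 2, x.2 2) * ((x.1 0 * x.2 0 - x.1 1 * x.2 1) / (2 * Real.pi))

theorem contDiff_heights : ContDiff ℝ ∞ fun x : E3 × E3 => (x.1 2, x.2 2) := by
  fun_prop

theorem contDiffAt_probeHamiltonian {h : ℝ × ℝ → ℝ} {x : E3 × E3}
    (hh : ContDiffAt ℝ ∞ h (x.1 2, x.2 2)) : ContDiffAt ℝ ∞ (probeHamiltonian h) x := by
  have h1 : ContDiffAt ℝ ∞ (fun x : E3 × E3 => h (x.1 2, x.2 2)) x :=
    hh.comp x contDiff_heights.contDiffAt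
  refine h1.mul (ContDiffAt.div_const ?_ _)
  fun_prop

theorem fderiv_probeHamiltonian {h : ℝ × ℝ → ℝ} {x : E3 × E3}
    (hh : ContDiffAt ℝ ∞ h (x.1 2, x.2 2)) (v : E3 × E3) :
    fderiv ℝ (probeHamiltonian h) x v =
      ((v.1 2 * fderiv ℝ h (x.1 2, x.2 2) (1, 0) + v.2 2 * fderiv ℝ h (x.1 2, x.2 2) (0, 1))
          * (x.1 0 * x.2 0 - x.1 1 * x.2 1)
        + h (x.1 2, x.2 2)
          * (v.1 0 * x.2 0 + x.1 0 * v.2 0 - (v.1 1 * x.2 1 + x.1 1 * v.2 1))) / (2 * Real.pi) := by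
  -- The differential is read off along the line `x + s v`, where both sides are derivatives of one
  -- real function.
  have hx : HasDerivAt (fun s : ℝ => x + s • v) v 0 := by
    simpa using ((hasDerivAt_id (0 : ℝ)).smul_const v).const_add x
  have hF : HasFDerivAt (probeHamiltonian h) (fderiv ℝ (probeHamiltonian h) x) (x + (0 : ℝ) • v) := by
    rw [zero_smul, add_zero]
    exact ((contDiffAt_probeHamiltonian hh).differentiableAt (by simp)).hasFDerivAt
  have h1 := hF.comp_hasDerivAt (0 : ℝ) hx
  have hlin : ∀ a b : ℝ, HasDerivAt (fun s : ℝ => a + s * b) b 0 := fun a b => by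
    simpa using ((hasDerivAt_id (0 : ℝ)).mul_const b).const_add a
  have hh' : HasFDerivAt h (fderiv ℝ h (x.1 2, x.2 2))
      (x.1 2 + (0 : ℝ) * v.1 2, x.2 2 + (0 : ℝ) * v.2 2) := by
    simp only [zero_mul, add_zero]
    exact (hh.differentiableAt (by simp)).hasFDerivAt
  have h2 := (hh'.comp_hasDerivAt (0 : ℝ) ((hlin (x.1 2) (v.1 2)).prodMk (hlin (x.2 2) (v.2 2)))).mul
    ((((hlin (x.1 0) (v.1 0)).mul (hlin (x.2 0) (v.2 0))).sub
      ((hlin (x.1 1) (v.1 1)).mul (hlin (x.2 1) (v.2 1)))).div_const (2 * Real.pi))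
  have h3 := h1.unique h2
  rw [h3]
  have h4 : fderiv ℝ h (x.1 2, x.2 2) (v.1 2, v.2 2)
      = v.1 2 * fderiv ℝ h (x.1 2, x.2 2) (1, 0) + v.2 2 * fderiv ℝ h (x.1 2, x.2 2) (0, 1) := by
    rw [← smul_eq_mul, ← smul_eq_mul, ← map_smul, ← map_smul, ← map_add]
    simp
  rw [h4]
  simp only [zero_mul, add_zero, Function.comp, Pi.mul_apply, Pi.sub_apply]
  ring

theorem inner_E3 (u v : E3) : inner ℝ u v = u 0 * v 0 + u 1 * v 1 + u 2 * v 2 := by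
  simp [PiLp.inner_apply, Fin.sum_univ_three]
  ring

theorem isHamiltonianFlow_of_isProbeCurve {α : ℝ} {h : ℝ × ℝ → ℝ} {φ : ℝ → S2xS2 → S2xS2}
    (hh : ∀ q : S2xS2, ContDiffAt ℝ ∞ h (height q.1, height q.2)) (h0 : ∀ p, φ 0 p = p)
    (hc : ∀ p, IsProbeCurve α h (fun t => φ t p)) :
    IsHamiltonianFlow α (fun q => probeHamiltonian h (inclX q.2)) φ := by
  refine isHamiltonianFlow_of_ambient (fun q => contDiffAt_probeHamiltonian (hh q)) h0
    (fun p => contDiff_coe_of_coords (hc p).zeta₁ (hc p).height₁)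
    (fun p => contDiff_coe_of_coords (hc p).zeta₂ (hc p).height₂) fun t p v₁ v₂ hv₁ hv₂ => ?_
  obtain ⟨d₁, d₂, e₁, e₂, hd₁, hd₂, he₁, he₂, E₁, E₂, E₃, E₄⟩ := (hc p).equation t
  rw [(hasDerivAt_coe_of_coords hd₁ he₁).deriv, (hasDerivAt_coe_of_coords hd₂ he₂).deriv,
    fderiv_probeHamiltonian (hh (φ t p))]
  have n₁ := sphere_eq (φ t p).1
  have n₂ := sphere_eq (φ t p).2
  rw [inner_E3] at hv₁ hv₂
  have A₁ := congrArg Complex.re E₁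
  have A₂ := congrArg Complex.im E₁
  have B₁ := congrArg Complex.re E₂
  have B₂ := congrArg Complex.im E₂
  simp only [inclX]
  change _ = ((_ * fderiv ℝ h (height (φ t p).1, height (φ t p).2) (1, 0)
    + _ * fderiv ℝ h (height (φ t p).1, height (φ t p).2) (0, 1)) * _
    + h (height (φ t p).1, height (φ t p).2) * _) / _
  generalize fderiv ℝ h (height (φ t p).1, height (φ t p).2) (1, 0) = k₁ at *
  generalize fderiv ℝ h (height (φ t p).1, height (φ t p).2) (0, 1) = k₂ at *
  generalize h (height (φ t p).1, height (φ t p).2) = k at *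
  simp [zeta, height] at A₁ A₂ B₁ B₂ E₃ E₄
  simp only [ambientAreaForm, Matrix.det_fin_three]
  simp
  generalize ((φ t p).1 : E3) = p₁ at *
  generalize ((φ t p).2 : E3) = p₂ at *
  have hpi := Real.pi_ne_zero
  field_simp
  -- In each factor `det (p, d, v) = d · (v × p)`, and the velocity `d` is `g × p` up to scale for
  -- the gradient `g`. Lagrange's identity gives `|p|² (g · v) - (g · p)(p · v)`; the sphere
  -- equation `n` and the tangency `hv` reduce this to `g · v`.
  linear_combination
    4 * ((p₁ 2 * v₁ 1 - p₁ 1 * v₁ 2) * A₁ + (p₁ 0 * v₁ 2 - p₁ 2 * v₁ 0) * A₂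
      + (p₁ 1 * v₁ 0 - p₁ 0 * v₁ 1) * E₃
      + (k * p₂ 0 * v₁ 0 - k * p₂ 1 * v₁ 1 + (p₁ 0 * p₂ 0 - p₁ 1 * p₂ 1) * k₁ * v₁ 2) * n₁
      - (k * p₂ 0 * p₁ 0 - k * p₂ 1 * p₁ 1 + (p₁ 0 * p₂ 0 - p₁ 1 * p₂ 1) * k₁ * p₁ 2) * hv₁)
    + 4 * ((p₂ 2 * v₂ 1 - p₂ 1 * v₂ 2) * B₁ + (p₂ 0 * v₂ 2 - p₂ 2 * v₂ 0) * B₂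
      + (p₂ 1 * v₂ 0 - p₂ 0 * v₂ 1) * E₄
      + (k * p₁ 0 * v₂ 0 - k * p₁ 1 * v₂ 1 + (p₁ 0 * p₂ 0 - p₁ 1 * p₂ 1) * k₂ * v₂ 2) * n₂
      - (k * p₁ 0 * p₂ 0 - k * p₁ 1 * p₂ 1 + (p₁ 0 * p₂ 0 - p₁ 1 * p₂ 1) * k₂ * p₂ 2) * hv₂)

/-! ### Rotations of the factors -/

/-- The rotation of the sphere by the angle `s` about the first coordinate axis. -/
def rotX (s : ℝ) (p : S2) : S2 :=
  spherePoint ⟨(p : E3) 0, Real.cos s * (p : E3) 1 - Real.sin s * (p : E3) 2⟩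
    (Real.sin s * (p : E3) 1 + Real.cos s * (p : E3) 2) (by
      rw [Complex.normSq_apply]
      linear_combination ((p : E3) 1 ^ 2 + (p : E3) 2 ^ 2) * Real.sin_sq_add_cos_sq s
        + sphere_eq p)

theorem zeta_rotX (s : ℝ) (p : S2) :
    zeta (rotX s p) = ⟨(zeta p).re, Real.cos s * (zeta p).im - Real.sin s * height p⟩ := rfl

theorem height_rotX (s : ℝ) (p : S2) :
    height (rotX s p) = Real.sin s * (zeta p).im + Real.cos s * height p := rfl

theorem rotX_zero (p : S2) : rotX 0 p = p := by
  refine S2_ext ?_ ?_ <;> simp [zeta_rotX, height_rotX]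

theorem rotX_pi_rotX_pi (p : S2) : rotX Real.pi (rotX Real.pi p) = p := by
  refine S2_ext ?_ ?_ <;> simp [zeta_rotX, height_rotX]

theorem contDiff_rotX (k : ℝ) (p : S2) : ContDiff ℝ ∞ fun t => (rotX (k * t) p : E3) := by
  rw [contDiff_euclidean]
  intro i
  fin_cases i
  · exact contDiff_const
  · change ContDiff ℝ ∞ fun t => Real.cos (k * t) * (p : E3) 1 - Real.sin (k * t) * (p : E3) 2
    fun_prop
  · change ContDiff ℝ ∞ fun t => Real.sin (k * t) * (p : E3) 1 + Real.cos (k * t) * (p : E3) 2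
    fun_prop

theorem hasDerivAt_rotX (k t : ℝ) (p : S2) : HasDerivAt (fun t => (rotX (k * t) p : E3))
    !₂[0, -k * (rotX (k * t) p : E3) 2, k * (rotX (k * t) p : E3) 1] t := by
  have hk : HasDerivAt (fun t => k * t) k t := by simpa using (hasDerivAt_id t).const_mul k
  have hs := (Real.hasDerivAt_sin (k * t)).comp t hk
  have hc := (Real.hasDerivAt_cos (k * t)).comp t hk
  refine hasDerivAt_E3 fun i => ?_
  fin_cases i
  · exact hasDerivAt_const t _
  · refine ((hc.mul_const ((p : E3) 1)).sub (hs.mul_const ((p : E3) 2))).congr_deriv ?_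
    simp [rotX, spherePoint]
    ring
  · refine ((hs.mul_const ((p : E3) 1)).add (hc.mul_const ((p : E3) 2))).congr_deriv ?_
    simp [rotX, spherePoint]
    ring

/-- The linear function that generates the rotations with angular velocities `k`, `l`. -/
def rotHamiltonian (α k l : ℝ) : E3 × E3 →L[ℝ] ℝ :=
  ((k * (α + 1)) / (2 * Real.pi)) •
      (EuclideanSpace.proj (0 : Fin 3) : E3 →L[ℝ] ℝ) ∘L ContinuousLinearMap.fst ℝ E3 E3
    + ((l * α) / (2 * Real.pi)) •
      (EuclideanSpace.proj (0 : Fin 3) : E3 →L[ℝ] ℝ) ∘L ContinuousLinearMap.snd ℝ E3 E3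

theorem isHamiltonianFlow_rot (α k l : ℝ) :
    IsHamiltonianFlow α (fun q => rotHamiltonian α k l (inclX q.2))
      (fun t p => (rotX (k * t) p.1, rotX (l * t) p.2)) := by
  refine isHamiltonianFlow_of_ambient (F := rotHamiltonian α k l)
    (fun q => (rotHamiltonian α k l).contDiff.contDiffAt)
    (fun p => ?_) (fun p => contDiff_rotX k p.1) (fun p => contDiff_rotX l p.2)
    fun t p v₁ v₂ hv₁ hv₂ => ?_
  · simp only [mul_zero, rotX_zero]
  · simp only at hv₁ hv₂ ⊢
    rw [(hasDerivAt_rotX k t p.1).deriv, (hasDerivAt_rotX l t p.2).deriv,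
      ContinuousLinearMap.fderiv]
    have n₁ := sphere_eq (rotX (k * t) p.1)
    have n₂ := sphere_eq (rotX (l * t) p.2)
    rw [inner_E3] at hv₁ hv₂
    generalize (rotX (k * t) p.1 : E3) = p₁ at *
    generalize (rotX (l * t) p.2 : E3) = p₂ at *
    simp only [ambientAreaForm, Matrix.det_fin_three, rotHamiltonian]
    simp
    have hpi := Real.pi_ne_zero
    field_simp
    linear_combination 4 * k * (α + 1) * (v₁ 0 * n₁ - p₁ 0 * hv₁)
      + 4 * l * α * (v₂ 0 * n₂ - p₂ 0 * hv₂)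

/-! ### Split tori -/

/-- Identifies split tori with fibres of the toric moment map, so that a flow need only be followed
through the two heights. -/
theorem mem_splitTorus_iff {α : ℝ} (hα : 0 < α) (x y : ℝ) (p : S2xS2) :
    p ∈ splitTorus α x y ↔ (α + 1) * height p.1 = x ∧ α * height p.2 = y := by
  rw [splitTorus, Set.mem_prod, mem_heightCircle_iff (by positivity),
    mem_heightCircle_iff (by positivity), eq_div_iff (by positivity), eq_div_iff (by positivity)]
  simp only [height]
  constructor <;> rintro ⟨h1, h2⟩ <;> constructor <;> linarith

/-- A right inverse on `L'` upgrades the inclusion `φ 1 '' L ⊆ L'` to an equality. -/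
theorem hamIsotopic_of_rightInverse {α : ℝ} {H : ℝ × S2xS2 → ℝ} {φ : ℝ → S2xS2 → S2xS2}
    (hφ : IsHamiltonianFlow α H φ) {L L' : Set S2xS2} (h : ∀ p ∈ L, φ 1 p ∈ L')
    {ψ : S2xS2 → S2xS2} (h' : ∀ p ∈ L', ψ p ∈ L) (hψ : ∀ p ∈ L', φ 1 (ψ p) = p) :
    HamIsotopic α L L' :=
  ⟨H, φ, hφ, Set.Subset.antisymm (Set.image_subset_iff.2 h) fun p hp => ⟨ψ p, h' p hp, hψ p hp⟩⟩

/-- A half turn of the first sphere about a horizontal axis reverses its height. -/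
theorem hamIsotopic_neg_left {α : ℝ} (hα : 0 < α) (x y : ℝ) :
    HamIsotopic α (splitTorus α x y) (splitTorus α (-x) y) := by
  refine hamIsotopic_of_rightInverse (isHamiltonianFlow_rot α Real.pi 0) (fun p hp => ?_)
    (ψ := fun p => (rotX Real.pi p.1, p.2)) (fun p hp => ?_) (fun p hp => ?_)
  · rw [mem_splitTorus_iff hα] at hp ⊢
    simp [height_rotX, hp.1, hp.2]
  · rw [mem_splitTorus_iff hα] at hp ⊢
    simp [height_rotX, hp.1, hp.2]
  · simp [rotX_pi_rotX_pi, rotX_zero]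

theorem hamIsotopic_neg_right {α : ℝ} (hα : 0 < α) (x y : ℝ) :
    HamIsotopic α (splitTorus α x y) (splitTorus α x (-y)) := by
  refine hamIsotopic_of_rightInverse (isHamiltonianFlow_rot α 0 Real.pi) (fun p hp => ?_)
    (ψ := fun p => (p.1, rotX Real.pi p.2)) (fun p hp => ?_) (fun p hp => ?_)
  · rw [mem_splitTorus_iff hα] at hp ⊢
    simp [height_rotX, hp.1, hp.2]
  · rw [mem_splitTorus_iff hα] at hp ⊢
    simp [height_rotX, hp.1, hp.2]
  · simp [rotX_pi_rotX_pi, rotX_zero]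

/-! ### Cut-off Hamiltonians along symmetric probes -/

/-- The moment map of the circle action that rotates the two factors in opposite directions. -/
def moment (α : ℝ) (p : S2xS2) : ℝ := (α + 1) * height p.1 - α * height p.2

/-- The function `χ((α + 1) z₁ - α z₂) f(z₁) g(z₂)`. -/
def probeFun (α : ℝ) (χ f g : ℝ → ℝ) (z : ℝ × ℝ) : ℝ :=
  χ ((α + 1) * z.1 - α * z.2) * (f z.1 * g z.2)

/-- Lets the cut-off absorb the singularities of `f` and `g` at the poles, which lie outside the
levels in the support of `χ`. -/
theorem probeFun_eventuallyEq_zero {α : ℝ} {χ : ℝ → ℝ} (f g : ℝ → ℝ) {z : ℝ × ℝ}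
    (hz : (α + 1) * z.1 - α * z.2 ∉ tsupport χ) : probeFun α χ f g =ᶠ[nhds z] fun _ => 0 := by
  have hc : Continuous fun z : ℝ × ℝ => (α + 1) * z.1 - α * z.2 := by fun_prop
  filter_upwards [hc.continuousAt.eventually (notMem_tsupport_iff_eventuallyEq.1 hz)] with w hw
  simp only [probeFun]
  rw [hw]
  simp

theorem contDiffAt_probeFun {α : ℝ} {χ f g : ℝ → ℝ} (hχ : ContDiff ℝ ∞ χ) {z : ℝ × ℝ}
    (hf : (α + 1) * z.1 - α * z.2 ∈ tsupport χ → ContDiffAt ℝ ∞ f z.1)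
    (hg : (α + 1) * z.1 - α * z.2 ∈ tsupport χ → ContDiffAt ℝ ∞ g z.2) :
    ContDiffAt ℝ ∞ (probeFun α χ f g) z := by
  by_cases hz : (α + 1) * z.1 - α * z.2 ∈ tsupport χ
  · refine ContDiffAt.mul (hχ.contDiffAt.comp z (by fun_prop)) (ContDiffAt.mul ?_ ?_)
    · exact (hf hz).comp z contDiffAt_fst
    · exact (hg hz).comp z contDiffAt_snd
  · exact contDiffAt_const.congr_of_eventuallyEq (probeFun_eventuallyEq_zero f g hz)

theorem fderiv_probeFun {α : ℝ} {χ f g : ℝ → ℝ} (hχ : ContDiff ℝ ∞ χ) {a b f' g' : ℝ}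
    (hf : HasDerivAt f f' a) (hg : HasDerivAt g g' b) :
    fderiv ℝ (probeFun α χ f g) (a, b) (1, 0)
        = deriv χ ((α + 1) * a - α * b) * (α + 1) * (f a * g b)
          + χ ((α + 1) * a - α * b) * (f' * g b) ∧
      fderiv ℝ (probeFun α χ f g) (a, b) (0, 1)
        = -deriv χ ((α + 1) * a - α * b) * α * (f a * g b)
          + χ ((α + 1) * a - α * b) * (f a * g') := by
  have hχ' : HasDerivAt χ (deriv χ ((α + 1) * a - α * b)) ((α + 1) * a - α * b) :=
    (hχ.differentiable (by simp) _).hasDerivAt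
  have h1 : HasFDerivAt (fun z : ℝ × ℝ => z.1) (ContinuousLinearMap.fst ℝ ℝ ℝ) (a, b) :=
    hasFDerivAt_fst
  have h2 : HasFDerivAt (fun z : ℝ × ℝ => z.2) (ContinuousLinearMap.snd ℝ ℝ ℝ) (a, b) :=
    hasFDerivAt_snd
  have h3 := HasDerivAt.comp_hasFDerivAt (h₂ := χ) (a, b) hχ'
    ((h1.const_mul (α + 1)).sub (h2.const_mul α))
  have h4 := HasDerivAt.comp_hasFDerivAt (h₂ := f) (a, b) hf h1
  have h5 := HasDerivAt.comp_hasFDerivAt (h₂ := g) (a, b) hg h2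
  have h6 : HasFDerivAt (probeFun α χ f g) _ (a, b) := h3.mul (h4.mul h5)
  rw [h6.fderiv]
  constructor <;> simp <;> ring

/-- The value `π` makes the time-one map a half turn of the reduced sphere at the level `c`. -/
theorem exists_cutoff {s : Set ℝ} {c : ℝ} (hs : IsOpen s) (hc : c ∈ s) :
    ∃ χ : ℝ → ℝ, ContDiff ℝ ∞ χ ∧ tsupport χ ⊆ s ∧ χ c = Real.pi := by
  obtain ⟨f, hf, -, hfs, -, hfc⟩ := exists_contDiff_tsupport_subset (n := ⊤) (hs.mem_nhds hc)
  refine ⟨fun x => Real.pi * f x, contDiff_const.mul hfs, ?_, by simp [hfc]⟩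
  exact (closure_mono (Function.support_mul_subset_right _ _)).trans hf

theorem isProbeCurve_const {α : ℝ} {χ : ℝ → ℝ} (f g : ℝ → ℝ) {p : S2xS2}
    (hp : moment α p ∉ tsupport χ) : IsProbeCurve α (probeFun α χ f g) (fun _ => p) := by
  refine ⟨contDiff_const, contDiff_const, contDiff_const, contDiff_const, fun t =>
    ⟨0, 0, 0, 0, hasDerivAt_const _ _, hasDerivAt_const _ _, hasDerivAt_const _ _,
      hasDerivAt_const _ _, ?_⟩⟩
  have h := probeFun_eventuallyEq_zero (α := α) f g (z := (height p.1, height p.2)) hp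
  rw [h.fderiv_eq, h.eq_of_nhds]
  simp

open Classical in
/-- A local flow on a union of levels of the moment map, extended by the identity. -/
def extendFlow (α : ℝ) (s : Set ℝ) (Φ : ℝ → S2xS2 → S2xS2) (t : ℝ) (p : S2xS2) : S2xS2 :=
  if moment α p ∈ s then Φ t p else p

/-- `IsHamiltonianFlow` constrains each orbit in time, so a case distinction on the initial point
needs no gluing. Orbits outside `s` may rest because the Hamiltonian vanishes near them. -/
theorem isHamiltonianFlow_extendFlow {α : ℝ} {χ f g : ℝ → ℝ} {s : Set ℝ} (hχ : ContDiff ℝ ∞ χ)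
    (hs : tsupport χ ⊆ s) {Φ : ℝ → S2xS2 → S2xS2}
    (hf : ∀ q, moment α q ∈ s → ContDiffAt ℝ ∞ f (height q.1))
    (hg : ∀ q, moment α q ∈ s → ContDiffAt ℝ ∞ g (height q.2))
    (h0 : ∀ p, moment α p ∈ s → Φ 0 p = p)
    (hc : ∀ p, moment α p ∈ s → IsProbeCurve α (probeFun α χ f g) (fun t => Φ t p)) :
    IsHamiltonianFlow α (fun q => probeHamiltonian (probeFun α χ f g) (inclX q.2))
      (extendFlow α s Φ) := by
  refine isHamiltonianFlow_of_isProbeCurve (fun q => ?_) (fun p => ?_) (fun p => ?_)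
  · exact contDiffAt_probeFun hχ (fun h => hf q (hs h)) (fun h => hg q (hs h))
  · by_cases hp : moment α p ∈ s
    · rw [extendFlow, if_pos hp, h0 p hp]
    · rw [extendFlow, if_neg hp]
  · by_cases hp : moment α p ∈ s
    · simp only [extendFlow, if_pos hp]
      exact hc p hp
    · simp only [extendFlow, if_neg hp]
      exact isProbeCurve_const f g fun h => hp (hs h)

/-- Two split tori on the same level of the moment map are Hamiltonian isotopic if they are
exchanged by the time-one map of a local flow. -/
theorem hamIsotopic_of_localFlow {α : ℝ} (hα : 0 < α) {χ f g : ℝ → ℝ} {s : Set ℝ}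
    (hχ : ContDiff ℝ ∞ χ) (hs : tsupport χ ⊆ s) {Φ : ℝ → S2xS2 → S2xS2}
    (hf : ∀ q, moment α q ∈ s → ContDiffAt ℝ ∞ f (height q.1))
    (hg : ∀ q, moment α q ∈ s → ContDiffAt ℝ ∞ g (height q.2))
    (h0 : ∀ p, moment α p ∈ s → Φ 0 p = p)
    (hc : ∀ p, moment α p ∈ s → IsProbeCurve α (probeFun α χ f g) (fun t => Φ t p))
    (hinv : ∀ p, moment α p ∈ s → Φ 1 (Φ (-1) p) = p) {x y x' y' : ℝ} (hμ : x - y ∈ s)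
    (hμ' : x' - y' = x - y)
    (h1 : ∀ p ∈ splitTorus α x y, Φ 1 p ∈ splitTorus α x' y')
    (h2 : ∀ p ∈ splitTorus α x' y', Φ (-1) p ∈ splitTorus α x y) :
    HamIsotopic α (splitTorus α x y) (splitTorus α x' y') := by
  have hm : ∀ {a b : ℝ} {p : S2xS2}, p ∈ splitTorus α a b → moment α p = a - b := by
    intro a b p hp
    rw [mem_splitTorus_iff hα] at hp
    rw [moment, hp.1, hp.2]
  refine hamIsotopic_of_rightInverse (isHamiltonianFlow_extendFlow hχ hs hf hg h0 hc)
    (ψ := Φ (-1)) (fun p hp => ?_) h2 (fun p hp => ?_)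
  · rw [extendFlow, if_pos (by rwa [hm hp])]
    exact h1 p hp
  · rw [extendFlow, if_pos (by rwa [hm (h2 p hp)])]
    exact hinv p (by rwa [hm hp, hμ'])

open Classical in
/-- The point of the sphere with given coordinates, or a default point. -/
def mkS2 (ζ : ℂ) (z : ℝ) : S2 :=
  if h : Complex.normSq ζ + z ^ 2 = 1 then spherePoint ζ z h
  else spherePoint 0 1 (by simp)

theorem zeta_mkS2 {ζ : ℂ} {z : ℝ} (h : Complex.normSq ζ + z ^ 2 = 1) : zeta (mkS2 ζ z) = ζ := by
  simp [mkS2, h]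

theorem height_mkS2 {ζ : ℂ} {z : ℝ} (h : Complex.normSq ζ + z ^ 2 = 1) : height (mkS2 ζ z) = z := by
  simp [mkS2, h]

/-! ### Probes between opposite facets -/

/-- The first height on the level `μ` of the moment map, in terms of the second height. -/
def bandHeight (α μ z : ℝ) : ℝ := (μ + α * z) / (α + 1)

/-- A level with `|μ| < 1` avoids the poles of the first sphere: the probe leaves the rectangle
through the facets of the second factor. -/
theorem bandHeight_sq_lt {α μ z : ℝ} (hα : 0 < α) (hμ : μ ∈ Set.Ioo (-1 : ℝ) 1)
    (hz : z ^ 2 ≤ 1) : 0 < 1 - bandHeight α μ z ^ 2 := by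
  have hz' := abs_le.1 ((sq_le_one_iff_abs_le_one z).1 hz)
  have h : |bandHeight α μ z| < 1 := by
    rw [abs_lt, bandHeight, lt_div_iff₀ (by linarith), div_lt_iff₀ (by linarith)]
    constructor <;> nlinarith [hμ.1, hμ.2]
  have := (sq_lt_one_iff_abs_lt_one _).2 h
  linarith

/-- The point on the level `μ` of the moment map with first angle `e` and second coordinates given,
in the frame rotated by `e`, by `(w, z)`. -/
def bandPoint (α μ : ℝ) (e w : ℂ) (z : ℝ) : S2xS2 :=
  (mkS2 (Real.sqrt (1 - bandHeight α μ z ^ 2) * e) (bandHeight α μ z),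
    mkS2 (w * (starRingEnd ℂ) e) z)

/-- The parameters `e`, `w`, `z` of a point in the sense of `bandPoint`. -/
structure IsBandParam (α μ : ℝ) (e w : ℂ) (z : ℝ) : Prop where
  pos : 0 < α
  mem : μ ∈ Set.Ioo (-1 : ℝ) 1
  normSq_e : Complex.normSq e = 1
  normSq_w : Complex.normSq w + z ^ 2 = 1

namespace IsBandParam

variable {α μ : ℝ} {e w : ℂ} {z : ℝ}

theorem radicand_pos (h : IsBandParam α μ e w z) : 0 < 1 - bandHeight α μ z ^ 2 :=
  bandHeight_sq_lt h.pos h.mem (by linarith [h.normSq_w, Complex.normSq_nonneg w])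

theorem coords₁ (h : IsBandParam α μ e w z) :
    Complex.normSq (Real.sqrt (1 - bandHeight α μ z ^ 2) * e) + bandHeight α μ z ^ 2 = 1 := by
  rw [Complex.normSq_mul, Complex.normSq_ofReal, Real.mul_self_sqrt h.radicand_pos.le, h.normSq_e]
  ring

theorem coords₂ (h : IsBandParam α μ e w z) :
    Complex.normSq (w * (starRingEnd ℂ) e) + z ^ 2 = 1 := by
  rw [Complex.normSq_mul, Complex.normSq_conj, h.normSq_e, mul_one, h.normSq_w]

theorem zeta₁ (h : IsBandParam α μ e w z) :
    zeta (bandPoint α μ e w z).1 = Real.sqrt (1 - bandHeight α μ z ^ 2) * e :=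
  zeta_mkS2 h.coords₁

theorem height₁ (h : IsBandParam α μ e w z) :
    height (bandPoint α μ e w z).1 = bandHeight α μ z :=
  height_mkS2 h.coords₁

theorem zeta₂ (h : IsBandParam α μ e w z) :
    zeta (bandPoint α μ e w z).2 = w * (starRingEnd ℂ) e :=
  zeta_mkS2 h.coords₂

theorem height₂ (h : IsBandParam α μ e w z) : height (bandPoint α μ e w z).2 = z :=
  height_mkS2 h.coords₂

theorem moment_eq (h : IsBandParam α μ e w z) : moment α (bandPoint α μ e w z) = μ := by
  have := h.pos
  rw [moment, h.height₁, h.height₂, bandHeight]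
  field_simp
  ring

theorem mul_conj (h : IsBandParam α μ e w z) : e * (starRingEnd ℂ) e = 1 := by
  rw [Complex.mul_conj, h.normSq_e, Complex.ofReal_one]

theorem norm_e (h : IsBandParam α μ e w z) : ‖e‖ = 1 := by
  have := h.normSq_e
  rw [Complex.normSq_eq_norm_sq] at this
  nlinarith [norm_nonneg e]

end IsBandParam

/-- The angle of the first point. -/
def bandAngle (p : S2xS2) : ℂ := zeta p.1 / (‖zeta p.1‖ : ℝ)

/-- Off the poles the first point has an angle `e`. The product `w = ζ₂ e` is invariant under the
opposite rotations, so `(w, z)` is a point of the reduced sphere and `e` is the position on the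
circle orbit. -/
theorem isBandParam_of_moment {α : ℝ} (hα : 0 < α) {p : S2xS2}
    (hp : moment α p ∈ Set.Ioo (-1 : ℝ) 1) :
    IsBandParam α (moment α p) (bandAngle p) (zeta p.2 * bandAngle p) (height p.2) ∧
      bandPoint α (moment α p) (bandAngle p) (zeta p.2 * bandAngle p) (height p.2) = p := by
  have hh : bandHeight α (moment α p) (height p.2) = height p.1 := by
    rw [bandHeight, moment]; field_simp; ring
  have hn := normSq_zeta p.1
  have h2 := normSq_zeta p.2
  have hz : (height p.2) ^ 2 ≤ 1 := by linarith [Complex.normSq_nonneg (zeta p.2)]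
  have hpos := bandHeight_sq_lt hα hp hz
  rw [hh, ← hn, Complex.normSq_eq_norm_sq] at hpos
  have hne : ‖zeta p.1‖ ≠ 0 := fun h => by simp [h] at hpos
  have he : Complex.normSq (bandAngle p) = 1 := by
    rw [bandAngle, Complex.normSq_div, Complex.normSq_ofReal, Complex.normSq_eq_norm_sq]
    field_simp
  have hP : IsBandParam α (moment α p) (bandAngle p) (zeta p.2 * bandAngle p) (height p.2) :=
    ⟨hα, hp, he, by rw [Complex.normSq_mul, he, h2]; ring⟩
  refine ⟨hP, Prod.ext (S2_ext ?_ ?_) (S2_ext ?_ ?_)⟩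
  · rw [hP.zeta₁, hh, ← hn, Complex.normSq_eq_norm_sq, Real.sqrt_sq (norm_nonneg _), bandAngle]
    rw [mul_div_cancel₀]
    exact_mod_cast hne
  · rw [hP.height₁, hh]
  · rw [hP.zeta₂, mul_assoc, hP.mul_conj, mul_one]
  · rw [hP.height₂]

theorem IsBandParam.bandAngle_eq {α μ : ℝ} {e w : ℂ} {z : ℝ} (h : IsBandParam α μ e w z) :
    bandAngle (bandPoint α μ e w z) = e := by
  have hs := Real.sqrt_pos.2 h.radicand_pos
  rw [bandAngle, h.zeta₁, norm_mul, h.norm_e, mul_one, Complex.norm_real, Real.norm_eq_abs,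
    abs_of_pos hs, mul_div_cancel_left₀]
  exact_mod_cast hs.ne'

/-- The rotation of the sphere of points `(w, z)` about the axis `Re w`, first coordinate. -/
def rotW (s : ℝ) (w : ℂ) (z : ℝ) : ℂ := ⟨w.re, Real.cos s * w.im - Real.sin s * z⟩

/-- The rotation of the sphere of points `(w, z)` about the axis `Re w`, second coordinate. -/
def rotZ (s : ℝ) (w : ℂ) (z : ℝ) : ℝ := Real.cos s * z + Real.sin s * w.im

theorem normSq_rotW (s : ℝ) (w : ℂ) (z : ℝ) :
    Complex.normSq (rotW s w z) + rotZ s w z ^ 2 = Complex.normSq w + z ^ 2 := by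
  simp only [Complex.normSq_apply, rotW, rotZ]
  linear_combination (w.im ^ 2 + z ^ 2) * Real.sin_sq_add_cos_sq s

theorem rotW_rotW (s t : ℝ) (w : ℂ) (z : ℝ) :
    rotW s (rotW t w z) (rotZ t w z) = rotW (s + t) w z := by
  simp only [rotW, rotZ, Real.cos_add, Real.sin_add]
  congr 1
  ring

theorem rotZ_rotZ (s t : ℝ) (w : ℂ) (z : ℝ) :
    rotZ s (rotW t w z) (rotZ t w z) = rotZ (s + t) w z := by
  simp only [rotW, rotZ, Real.cos_add, Real.sin_add]
  ring

/-- The flow of `χ(μ) √(α² - y²) cos (θ₁ + θ₂)` in terms of parameters. -/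
def bandCurve (α : ℝ) (χ : ℝ → ℝ) (μ : ℝ) (e w : ℂ) (z t : ℝ) : S2xS2 :=
  bandPoint α μ (e * Complex.exp ((deriv χ μ * (α * w.re) * t : ℝ) * Complex.I))
    (rotW (χ μ * t) w z) (rotZ (χ μ * t) w z)

/-- The flow of `χ(μ) √(α² - y²) cos (θ₁ + θ₂)`. -/
def bandFlow (α : ℝ) (χ : ℝ → ℝ) (t : ℝ) (p : S2xS2) : S2xS2 :=
  bandCurve α χ (moment α p) (bandAngle p) (zeta p.2 * bandAngle p) (height p.2) t

theorem normSq_exp_ofReal_mul_I (x : ℝ) : Complex.normSq (Complex.exp (x * Complex.I)) = 1 := by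
  rw [Complex.normSq_eq_norm_sq, Complex.norm_exp_ofReal_mul_I, one_pow]

theorem IsBandParam.curve {α μ : ℝ} {e w : ℂ} {z : ℝ} (h : IsBandParam α μ e w z) (x s : ℝ) :
    IsBandParam α μ (e * Complex.exp (x * Complex.I)) (rotW s w z) (rotZ s w z) :=
  ⟨h.pos, h.mem, by rw [Complex.normSq_mul, h.normSq_e, normSq_exp_ofReal_mul_I, one_mul],
    by rw [normSq_rotW, h.normSq_w]⟩

theorem IsBandParam.bandFlow_bandPoint {α μ : ℝ} {e w : ℂ} {z : ℝ} (h : IsBandParam α μ e w z)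
    (χ : ℝ → ℝ) (t : ℝ) : bandFlow α χ t (bandPoint α μ e w z) = bandCurve α χ μ e w z t := by
  rw [bandFlow, h.moment_eq, h.bandAngle_eq, h.zeta₂, h.height₂, mul_assoc,
    mul_comm ((starRingEnd ℂ) e), h.mul_conj, mul_one]

theorem bandFlow_zero {α : ℝ} (hα : 0 < α) (χ : ℝ → ℝ) {p : S2xS2}
    (hp : moment α p ∈ Set.Ioo (-1 : ℝ) 1) : bandFlow α χ 0 p = p := by
  conv_rhs => rw [← (isBandParam_of_moment hα hp).2]
  simp only [bandFlow, bandCurve, rotW, rotZ, mul_zero, Real.cos_zero, Real.sin_zero, one_mul,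
    zero_mul, sub_zero, add_zero, Complex.ofReal_zero, Complex.exp_zero, mul_one]

/-- The level and `Re w` are constant along the flow, so both the rotation speed and the phase speed
are the same at the later starting point. -/
theorem bandFlow_bandFlow {α : ℝ} (hα : 0 < α) (χ : ℝ → ℝ) {p : S2xS2}
    (hp : moment α p ∈ Set.Ioo (-1 : ℝ) 1) (s t : ℝ) :
    bandFlow α χ s (bandFlow α χ t p) = bandFlow α χ (s + t) p := by
  have h := (isBandParam_of_moment hα hp).1
  conv_lhs => rw [bandFlow.eq_def α χ t p, bandCurve]
  rw [(h.curve _ _).bandFlow_bandPoint, bandFlow, bandCurve, bandCurve, rotW_rotW, rotZ_rotZ,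
    mul_assoc (bandAngle p), ← Complex.exp_add, ← mul_add, ← add_mul, ← Complex.ofReal_add]
  congr 4
  simp only [rotW]
  congr 1
  ring

theorem hasDerivAt_rotW_im (k t : ℝ) (w : ℂ) (z : ℝ) :
    HasDerivAt (fun t => (rotW (k * t) w z).im) (-(k * rotZ (k * t) w z)) t := by
  have hk : HasDerivAt (fun t => k * t) k t := by simpa using (hasDerivAt_id t).const_mul k
  have hs := (Real.hasDerivAt_sin (k * t)).comp t hk
  have hc := (Real.hasDerivAt_cos (k * t)).comp t hk
  refine ((hc.mul_const w.im).sub (hs.mul_const z)).congr_deriv ?_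
  simp only [rotZ]
  ring

theorem hasDerivAt_rotZ (k t : ℝ) (w : ℂ) (z : ℝ) :
    HasDerivAt (fun t => rotZ (k * t) w z) (k * (rotW (k * t) w z).im) t := by
  have hk : HasDerivAt (fun t => k * t) k t := by simpa using (hasDerivAt_id t).const_mul k
  have hs := (Real.hasDerivAt_sin (k * t)).comp t hk
  have hc := (Real.hasDerivAt_cos (k * t)).comp t hk
  refine ((hc.mul_const z).add (hs.mul_const w.im)).congr_deriv ?_
  simp only [rotW]
  ring

theorem hasDerivAt_rotW (k t : ℝ) (w : ℂ) (z : ℝ) :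
    HasDerivAt (fun t => rotW (k * t) w z) (-(k * rotZ (k * t) w z : ℝ) * Complex.I) t := by
  have h := ((hasDerivAt_rotW_im k t w z).ofReal_comp.mul_const Complex.I).const_add (w.re : ℂ)
  have e : (fun t => rotW (k * t) w z)
      = fun t => (w.re : ℂ) + (((rotW (k * t) w z).im : ℝ) : ℂ) * Complex.I := by
    funext t
    exact (Complex.re_add_im (rotW (k * t) w z)).symm
  rw [e]
  refine h.congr_deriv ?_
  push_cast
  ring

theorem hasDerivAt_mul_exp (e : ℂ) (k t : ℝ) :
    HasDerivAt (fun t : ℝ => e * Complex.exp ((k * t : ℝ) * Complex.I))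
      (k * Complex.I * (e * Complex.exp ((k * t : ℝ) * Complex.I))) t := by
  have hk : HasDerivAt (fun t : ℝ => k * t) k t := by simpa using (hasDerivAt_id t).const_mul k
  have h := ((hk.ofReal_comp.mul_const Complex.I).cexp).const_mul e
  refine h.congr_deriv ?_
  ring

theorem contDiff_ofReal_comp {f : ℝ → ℝ} (hf : ContDiff ℝ ∞ f) :
    ContDiff ℝ ∞ fun t => (f t : ℂ) :=
  Complex.ofRealCLM.contDiff.comp hf

theorem contDiff_conj_comp {f : ℝ → ℂ} (hf : ContDiff ℝ ∞ f) :
    ContDiff ℝ ∞ fun t => (starRingEnd ℂ) (f t) :=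
  Complex.conjCLE.contDiff.comp hf

theorem hasDerivAt_conj_comp {f : ℝ → ℂ} {f' : ℂ} {t : ℝ} (hf : HasDerivAt f f' t) :
    HasDerivAt (fun t => (starRingEnd ℂ) (f t)) ((starRingEnd ℂ) f') t :=
  Complex.conjCLE.toContinuousLinearMap.hasFDerivAt.comp_hasDerivAt t hf

theorem contDiff_mul_exp (e : ℂ) (k : ℝ) :
    ContDiff ℝ ∞ fun t : ℝ => e * Complex.exp ((k * t : ℝ) * Complex.I) :=
  contDiff_const.mul (((contDiff_ofReal_comp (contDiff_const.mul contDiff_id)).mul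
    contDiff_const).cexp)

theorem contDiff_rotW (k : ℝ) (w : ℂ) (z : ℝ) : ContDiff ℝ ∞ fun t => rotW (k * t) w z := by
  have e : (fun t => rotW (k * t) w z)
      = fun t => (w.re : ℂ) + (((rotW (k * t) w z).im : ℝ) : ℂ) * Complex.I := by
    funext t
    exact (Complex.re_add_im (rotW (k * t) w z)).symm
  rw [e]
  refine contDiff_const.add ((contDiff_ofReal_comp ?_).mul contDiff_const)
  simp only [rotW]
  fun_prop

theorem contDiff_rotZ (k : ℝ) (w : ℂ) (z : ℝ) : ContDiff ℝ ∞ fun t => rotZ (k * t) w z := by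
  simp only [rotZ]
  fun_prop

theorem hasDerivAt_const_div_sqrt {a : ℝ} (α : ℝ) (ha : 0 < 1 - a ^ 2) :
    HasDerivAt (fun a => α / Real.sqrt (1 - a ^ 2)) (α * a / Real.sqrt (1 - a ^ 2) ^ 3) a := by
  have h1 : HasDerivAt (fun a : ℝ => 1 - a ^ 2) (-(2 * a)) a := by
    simpa using (hasDerivAt_pow 2 a).const_sub 1
  have hs := (Real.sqrt_pos.2 ha).ne'
  refine ((hasDerivAt_const a α).div (h1.sqrt ha.ne') hs).congr_deriv ?_
  field_simp
  ring

/-- On the band the Hamiltonian is `χ(μ) G` with `G = α Re w`, up to the factor `2π`. The term `χ(μ)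
dG` rotates the reduced sphere about the axis `Re w` with speed `χ(μ)`. The term `G χ'(μ) dμ` moves
along the circle orbits, which produces the phase `κ t`. -/
theorem IsBandParam.isProbeCurve {α μ : ℝ} {e w : ℂ} {z : ℝ} (h : IsBandParam α μ e w z)
    {χ : ℝ → ℝ} (hχ : ContDiff ℝ ∞ χ) :
    IsProbeCurve α (probeFun α χ (fun a => α / Real.sqrt (1 - a ^ 2)) fun _ => 1)
      (bandCurve α χ μ e w z) := by
  have hβ : α + 1 ≠ 0 := by linarith [h.pos]
  set κ := deriv χ μ * (α * w.re) with hκ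
  set k := χ μ with hk
  set E : ℝ → ℂ := fun t => e * Complex.exp ((κ * t : ℝ) * Complex.I) with hE
  set W : ℝ → ℂ := fun t => rotW (k * t) w z with hW
  set Z : ℝ → ℝ := fun t => rotZ (k * t) w z with hZ
  set A : ℝ → ℝ := fun t => bandHeight α μ (Z t) with hA
  set R : ℝ → ℝ := fun t => Real.sqrt (1 - A t ^ 2) with hR
  have hP : ∀ t, IsBandParam α μ (E t) (W t) (Z t) := fun t => h.curve _ _
  have hc : bandCurve α χ μ e w z = fun t => bandPoint α μ (E t) (W t) (Z t) := rfl
  have z₁ : ∀ t, zeta (bandPoint α μ (E t) (W t) (Z t)).1 = R t * E t := fun t => (hP t).zeta₁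
  have z₂ : ∀ t, zeta (bandPoint α μ (E t) (W t) (Z t)).2 = W t * (starRingEnd ℂ) (E t) :=
    fun t => (hP t).zeta₂
  have y₁ : ∀ t, height (bandPoint α μ (E t) (W t) (Z t)).1 = A t := fun t => (hP t).height₁
  have y₂ : ∀ t, height (bandPoint α μ (E t) (W t) (Z t)).2 = Z t := fun t => (hP t).height₂
  have hpos : ∀ t, 0 < 1 - A t ^ 2 := fun t => (hP t).radicand_pos
  have cE : ContDiff ℝ ∞ E := contDiff_mul_exp _ _
  have cW : ContDiff ℝ ∞ W := contDiff_rotW _ _ _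
  have cZ : ContDiff ℝ ∞ Z := contDiff_rotZ _ _ _
  have cA : ContDiff ℝ ∞ A := (contDiff_const.add (contDiff_const.mul cZ)).div_const _
  have cR : ContDiff ℝ ∞ R := (contDiff_const.sub (cA.pow 2)).sqrt fun t => (hpos t).ne'
  rw [hc]
  refine ⟨?_, ?_, ?_, ?_, fun t => ?_⟩ <;> simp only [z₁, z₂, y₁, y₂]
  · exact (contDiff_ofReal_comp cR).mul cE
  · exact cW.mul (contDiff_conj_comp cE)
  · exact cA
  · exact cZ
  have dE : HasDerivAt E (κ * Complex.I * E t) t := hasDerivAt_mul_exp e κ t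
  have dE' := hasDerivAt_conj_comp dE
  have dW : HasDerivAt W (-(k * Z t : ℝ) * Complex.I) t := hasDerivAt_rotW k t w z
  have dZ : HasDerivAt Z (k * (W t).im) t := hasDerivAt_rotZ k t w z
  have dA : HasDerivAt A (α * (k * (W t).im) / (α + 1)) t :=
    ((dZ.const_mul α).const_add μ).div_const (α + 1)
  have dR : HasDerivAt R (-(A t * (α * (k * (W t).im) / (α + 1))) / R t) t := by
    refine (((dA.pow 2).const_sub 1).sqrt (hpos t).ne').congr_deriv ?_
    have hRne : R t ≠ 0 := (Real.sqrt_pos.2 (hpos t)).ne'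
    change _ / (2 * R t) = _
    field_simp
    push_cast
    ring
  refine ⟨_, _, _, _, dR.ofReal_comp.mul dE, dW.mul dE', dA, dZ, ?_⟩
  have hm : (α + 1) * A t - α * Z t = μ := by
    simp only [hA, bandHeight]
    field_simp
    ring
  obtain ⟨D₁, D₂⟩ := fderiv_probeFun (α := α) hχ (hasDerivAt_const_div_sqrt α (hpos t))
    (hasDerivAt_const (Z t) (1 : ℝ))
  rw [hm] at D₁ D₂
  change _ = _ * (α / R t * 1) + k * (α * A t / R t ^ 3 * 1) at D₁
  change _ = _ * (α / R t * 1) + k * (α / R t * 0) at D₂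
  rw [D₁, D₂, probeFun, hm]
  -- The phase `E` cancels because the two factors rotate in opposite directions.
  have hmul : (R t : ℂ) * E t * (W t * (starRingEnd ℂ) (E t)) = R t * W t := by
    linear_combination R t * W t * (hP t).mul_conj
  rw [hmul, Complex.re_ofReal_mul, Complex.im_ofReal_mul]
  have hWre : (W t).re = w.re := rfl
  have hRne : R t ≠ 0 := (Real.sqrt_pos.2 (hpos t)).ne'
  have hRne' : (R t : ℂ) ≠ 0 := by exact_mod_cast hRne
  have hβ' : (α + 1 : ℂ) ≠ 0 := by exact_mod_cast hβ
  have hWd : W t = w.re + (W t).im * Complex.I := (Complex.re_add_im (W t)).symm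
  have hWc : (starRingEnd ℂ) (W t) = w.re - (W t).im * Complex.I := by
    rw [hWd]; simp [sub_eq_add_neg]
  change _ ∧ _ ∧ (α + 1) * _ = k * (α / R t * 1) * (R t * _) ∧ α * _ = k * (α / R t * 1) * (R t * _)
  refine ⟨?_, ?_, ?_, ?_⟩
  · change _ = _ * (_ - ((k * (α / R t * 1) * A t : ℝ) : ℂ) * _)
    rw [hWre, map_mul, Complex.conj_conj, hWc, hκ]
    push_cast
    field_simp
    ring_nf
    simp only [Complex.I_sq]
    ring
  · change _ = _ * (_ - ((k * (α / R t * 1) * Z t : ℝ) : ℂ) * _)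
    have c₁ : (starRingEnd ℂ) (κ * Complex.I * E t) = -(κ * Complex.I) * (starRingEnd ℂ) (E t) := by
      rw [map_mul, map_mul, Complex.conj_ofReal, Complex.conj_I]
      ring
    have c₂ : (starRingEnd ℂ) (R t * E t) = R t * (starRingEnd ℂ) (E t) := by
      rw [map_mul, Complex.conj_ofReal]
    rw [hWre, c₁, c₂, hκ]
    push_cast
    field_simp
    ring_nf
  · field_simp
  · field_simp

/-- The half turn of the reduced sphere sends `z₂` to `-z₂` while `x - y` is preserved. This is the
reflection of the probe at its midpoint `(x - y, 0)`. -/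
theorem hamIsotopic_shear {α : ℝ} (hα : 0 < α) {x y : ℝ} (hxy : |x - y| < 1) :
    HamIsotopic α (splitTorus α x y) (splitTorus α (x - 2 * y) (-y)) := by
  have hU : x - y ∈ Set.Ioo (-1 : ℝ) 1 := abs_lt.1 hxy
  obtain ⟨χ, hχ, hs, hc⟩ := exists_cutoff isOpen_Ioo hU
  -- Turning by `π` or by `-π` has the same effect on heights, so one computation serves the flow
  -- and its inverse.
  have hflow : ∀ s : ℝ, (s = 1 ∨ s = -1) → ∀ a b : ℝ, a - b = x - y → ∀ p ∈ splitTorus α a b,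
      bandFlow α χ s p ∈ splitTorus α (a - 2 * b) (-b) := by
    intro s hs' a b hab p hp
    rw [mem_splitTorus_iff hα] at hp
    have hm : moment α p = x - y := by rw [moment, hp.1, hp.2, hab]
    have hP := (isBandParam_of_moment hα (hm ▸ hU)).1
    have hP' := hP.curve (deriv χ (moment α p) * (α * (zeta p.2 * bandAngle p).re) * s)
      (χ (moment α p) * s)
    have hz : rotZ (χ (moment α p) * s) (zeta p.2 * bandAngle p) (height p.2) = -height p.2 := by
      rw [hm, hc]
      rcases hs' with rfl | rfl <;> simp [rotZ]
    rw [mem_splitTorus_iff hα, bandFlow, bandCurve, hP'.height₁, hP'.height₂, hz, bandHeight, hm]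
    have : α + 1 ≠ 0 := by linarith
    constructor
    · field_simp
      linarith [hp.2]
    · linarith [hp.2]
  refine hamIsotopic_of_localFlow hα hχ hs (Φ := bandFlow α χ)
    (f := fun a => α / Real.sqrt (1 - a ^ 2)) (g := fun _ => 1)
    (fun q hq => ?_) (fun q _ => contDiffAt_const) (fun p hp => bandFlow_zero hα χ hp)
    (fun p hp => (isBandParam_of_moment hα hp).1.isProbeCurve hχ) (fun p hp => ?_) hU (by ring)
    (hflow 1 (Or.inl rfl) x y rfl) (fun p hp => ?_)
  · have h := isBandParam_of_moment hα hq
    have h1 := h.1.radicand_pos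
    rw [← h.1.height₁, h.2] at h1
    refine contDiffAt_const.div ?_ (Real.sqrt_pos.2 h1).ne'
    exact (contDiffAt_const.sub (contDiffAt_id.pow 2)).sqrt h1.ne'
  · rw [bandFlow_bandFlow hα χ hp, add_neg_cancel, bandFlow_zero hα χ hp]
  · have h := hflow (-1) (Or.inr rfl) (x - 2 * y) (-y) (by ring) p hp
    convert h using 2 <;> ring

/-! ### Probes between adjacent facets -/

/-- The point with Darboux coordinates `A` at the top of the first factor and `conj C` at the bottom
of the second factor. -/
def cornerPoint (A C : ℂ) : S2xS2 :=
  (mkS2 (Real.sqrt (2 - Complex.normSq A) * A) (1 - Complex.normSq A),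
    mkS2 (Real.sqrt (2 - Complex.normSq C) * (starRingEnd ℂ) C) (Complex.normSq C - 1))

/-- The parameters of a point on the level `μ` in the sense of `cornerPoint`. -/
structure IsCornerParam (α μ : ℝ) (A C : ℂ) : Prop where
  pos : 0 < α
  lt : 1 < μ
  level : (α + 1) * Complex.normSq A + α * Complex.normSq C = 2 * α + 1 - μ

namespace IsCornerParam

variable {α μ : ℝ} {A C : ℂ}

/-- For `μ > 1` the level equation bounds `(α + 1)|A|²` by less than `2α`, which keeps the first
point off its lower pole. -/
theorem radicand₁_pos (h : IsCornerParam α μ A C) : 0 < 2 - Complex.normSq A := by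
  have h1 := h.pos
  have h2 := h.lt
  have h3 := h.level
  have h4 := mul_nonneg h1.le (Complex.normSq_nonneg C)
  nlinarith

theorem radicand₂_pos (h : IsCornerParam α μ A C) : 0 < 2 - Complex.normSq C := by
  have h1 := h.pos
  have h2 := h.lt
  have h3 := h.level
  have h4 := mul_nonneg (by linarith : 0 ≤ α + 1) (Complex.normSq_nonneg A)
  have h5 : 0 < α * (2 - Complex.normSq C) := by linarith
  exact pos_of_mul_pos_right h5 h1.le

theorem coords₁ (h : IsCornerParam α μ A C) :
    Complex.normSq (Real.sqrt (2 - Complex.normSq A) * A) + (1 - Complex.normSq A) ^ 2 = 1 := by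
  rw [Complex.normSq_mul, Complex.normSq_ofReal, Real.mul_self_sqrt h.radicand₁_pos.le]
  ring

theorem coords₂ (h : IsCornerParam α μ A C) :
    Complex.normSq (Real.sqrt (2 - Complex.normSq C) * (starRingEnd ℂ) C)
      + (Complex.normSq C - 1) ^ 2 = 1 := by
  rw [Complex.normSq_mul, Complex.normSq_ofReal, Real.mul_self_sqrt h.radicand₂_pos.le,
    Complex.normSq_conj]
  ring

theorem zeta₁ (h : IsCornerParam α μ A C) :
    zeta (cornerPoint A C).1 = Real.sqrt (2 - Complex.normSq A) * A :=
  zeta_mkS2 h.coords₁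

theorem height₁ (h : IsCornerParam α μ A C) :
    height (cornerPoint A C).1 = 1 - Complex.normSq A :=
  height_mkS2 h.coords₁

theorem zeta₂ (h : IsCornerParam α μ A C) :
    zeta (cornerPoint A C).2 = Real.sqrt (2 - Complex.normSq C) * (starRingEnd ℂ) C :=
  zeta_mkS2 h.coords₂

theorem height₂ (h : IsCornerParam α μ A C) :
    height (cornerPoint A C).2 = Complex.normSq C - 1 :=
  height_mkS2 h.coords₂

theorem moment_eq (h : IsCornerParam α μ A C) : moment α (cornerPoint A C) = μ := by
  rw [moment, h.height₁, h.height₂]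
  linarith [h.level]

end IsCornerParam

/-- The Darboux coordinate of the first point. -/
def cornerA (p : S2xS2) : ℂ := zeta p.1 / (Real.sqrt (1 + height p.1) : ℝ)

/-- The conjugate of the Darboux coordinate of the second point. -/
def cornerC (p : S2xS2) : ℂ := (starRingEnd ℂ) (zeta p.2) / (Real.sqrt (1 - height p.2) : ℝ)

theorem one_add_height_pos {α : ℝ} (hα : 0 < α) {p : S2xS2} (hp : 1 < moment α p) :
    0 < 1 + height p.1 := by
  have h2 := height_mem p.2
  rw [moment] at hp
  have : 0 < (α + 1) * (1 + height p.1) := by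
    nlinarith [h2.1, mul_nonneg hα.le (by linarith [h2.1] : 0 ≤ height p.2 + 1)]
  exact pos_of_mul_pos_right this (by linarith)

theorem one_sub_height_pos {α : ℝ} (hα : 0 < α) {p : S2xS2} (hp : 1 < moment α p) :
    0 < 1 - height p.2 := by
  have h1 := height_mem p.1
  rw [moment] at hp
  have : 0 < α * (1 - height p.2) := by
    nlinarith [mul_nonneg (by linarith : 0 ≤ α + 1) (by linarith [h1.2] : 0 ≤ 1 - height p.1)]
  exact pos_of_mul_pos_right this hα.le

theorem normSq_cornerA {p : S2xS2} (h : 0 < 1 + height p.1) :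
    Complex.normSq (cornerA p) = 1 - height p.1 := by
  rw [cornerA, Complex.normSq_div, Complex.normSq_ofReal, Real.mul_self_sqrt h.le, normSq_zeta]
  field_simp
  ring

theorem normSq_cornerC {p : S2xS2} (h : 0 < 1 - height p.2) :
    Complex.normSq (cornerC p) = 1 + height p.2 := by
  rw [cornerC, Complex.normSq_div, Complex.normSq_ofReal, Real.mul_self_sqrt h.le,
    Complex.normSq_conj, normSq_zeta]
  field_simp
  ring

/-- Only the upper pole of the first factor and the lower pole of the second can occur on these
levels, and `A`, `C` are regular there. -/
theorem isCornerParam_of_moment {α : ℝ} (hα : 0 < α) {p : S2xS2} (hp : 1 < moment α p) :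
    IsCornerParam α (moment α p) (cornerA p) (cornerC p) ∧
      cornerPoint (cornerA p) (cornerC p) = p := by
  have h1 := one_add_height_pos hα hp
  have h2 := one_sub_height_pos hα hp
  have n1 := normSq_cornerA h1
  have n2 := normSq_cornerC h2
  have hP : IsCornerParam α (moment α p) (cornerA p) (cornerC p) :=
    ⟨hα, hp, by rw [n1, n2, moment]; ring⟩
  have s1 := (Real.sqrt_pos.2 h1).ne'
  have s2 := (Real.sqrt_pos.2 h2).ne'
  refine ⟨hP, Prod.ext (S2_ext ?_ ?_) (S2_ext ?_ ?_)⟩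
  · rw [hP.zeta₁, n1, cornerA, show 2 - (1 - height p.1) = 1 + height p.1 by ring, mul_div_cancel₀]
    exact_mod_cast s1
  · rw [hP.height₁, n1]; ring
  · rw [hP.zeta₂, n2, cornerC, show 2 - (1 + height p.2) = 1 - height p.2 by ring, map_div₀,
      Complex.conj_conj, Complex.conj_ofReal, mul_div_cancel₀]
    exact_mod_cast s2
  · rw [hP.height₂, n2]; ring

theorem IsCornerParam.cornerA_eq {α μ : ℝ} {A C : ℂ} (h : IsCornerParam α μ A C) :
    cornerA (cornerPoint A C) = A := by
  have hs := (Real.sqrt_pos.2 h.radicand₁_pos).ne'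
  rw [cornerA, h.zeta₁, h.height₁,
    show 1 + (1 - Complex.normSq A) = 2 - Complex.normSq A by ring, mul_div_cancel_left₀]
  exact_mod_cast hs

theorem IsCornerParam.cornerC_eq {α μ : ℝ} {A C : ℂ} (h : IsCornerParam α μ A C) :
    cornerC (cornerPoint A C) = C := by
  have hs := (Real.sqrt_pos.2 h.radicand₂_pos).ne'
  rw [cornerC, h.zeta₂, h.height₂, map_mul, Complex.conj_conj, Complex.conj_ofReal,
    show 1 - (Complex.normSq C - 1) = 2 - Complex.normSq C by ring, mul_div_cancel_left₀]
  exact_mod_cast hs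

/-- The geometric mean of `α` and `α + 1`. -/
def meanRoot (α : ℝ) : ℝ := Real.sqrt (α * (α + 1))

theorem meanRoot_sq {α : ℝ} (hα : 0 < α) : meanRoot α ^ 2 = α * (α + 1) :=
  Real.sq_sqrt (by positivity)

/-- First coordinate of the unitary rotation of `ℂ²` with scaled coordinates `A`, `C`. -/
def mixA (α s : ℝ) (A C : ℂ) : ℂ :=
  (Real.cos s : ℝ) * A - Complex.I * ((meanRoot α / (α + 1) * Real.sin s : ℝ) * C)

/-- Second coordinate of the unitary rotation of `ℂ²` with scaled coordinates `A`, `C`. -/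
def mixC (α s : ℝ) (A C : ℂ) : ℂ :=
  (Real.cos s : ℝ) * C - Complex.I * ((meanRoot α / α * Real.sin s : ℝ) * A)

theorem mixA_zero (α : ℝ) (A C : ℂ) : mixA α 0 A C = A := by simp [mixA]

theorem mixC_zero (α : ℝ) (A C : ℂ) : mixC α 0 A C = C := by simp [mixC]

theorem mixA_smul (α s : ℝ) (c A C : ℂ) : mixA α s (c * A) (c * C) = c * mixA α s A C := by
  simp only [mixA]; ring

theorem mixC_smul (α s : ℝ) (c A C : ℂ) : mixC α s (c * A) (c * C) = c * mixC α s A C := by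
  simp only [mixC]; ring

/-- The off-diagonal factors `meanRoot α / (α + 1)` and `meanRoot α / α` have product `1`, so the
maps compose by the addition theorems. -/
theorem mixA_mix {α : ℝ} (hα : 0 < α) (s t : ℝ) (A C : ℂ) :
    mixA α s (mixA α t A C) (mixC α t A C) = mixA α (s + t) A C := by
  have hβ : (α + 1 : ℂ) ≠ 0 := by exact_mod_cast (by linarith : α + 1 ≠ 0)
  have hα' : (α : ℂ) ≠ 0 := by exact_mod_cast hα.ne'
  have hm : (meanRoot α : ℂ) ^ 2 = α * (α + 1) := by exact_mod_cast meanRoot_sq hα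
  simp only [mixA, mixC, Real.cos_add, Real.sin_add]
  push_cast
  field_simp
  ring_nf
  simp only [Complex.I_sq, hm]
  ring

theorem mixC_mix {α : ℝ} (hα : 0 < α) (s t : ℝ) (A C : ℂ) :
    mixC α s (mixA α t A C) (mixC α t A C) = mixC α (s + t) A C := by
  have hβ : (α + 1 : ℂ) ≠ 0 := by exact_mod_cast (by linarith : α + 1 ≠ 0)
  have hα' : (α : ℂ) ≠ 0 := by exact_mod_cast hα.ne'
  have hm : (meanRoot α : ℂ) ^ 2 = α * (α + 1) := by exact_mod_cast meanRoot_sq hα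
  simp only [mixA, mixC, Real.cos_add, Real.sin_add]
  push_cast
  field_simp
  ring_nf
  simp only [Complex.I_sq, hm]
  ring

theorem mixA_re (α s : ℝ) (A C : ℂ) :
    (mixA α s A C).re = Real.cos s * A.re + meanRoot α / (α + 1) * Real.sin s * C.im := by
  rw [mixA, Complex.sub_re, Complex.re_ofReal_mul, Complex.I_mul_re, Complex.im_ofReal_mul]
  ring

theorem mixA_im (α s : ℝ) (A C : ℂ) :
    (mixA α s A C).im = Real.cos s * A.im - meanRoot α / (α + 1) * Real.sin s * C.re := by
  rw [mixA, Complex.sub_im, Complex.im_ofReal_mul, Complex.I_mul_im, Complex.re_ofReal_mul]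

theorem mixC_re (α s : ℝ) (A C : ℂ) :
    (mixC α s A C).re = Real.cos s * C.re + meanRoot α / α * Real.sin s * A.im := by
  rw [mixC, Complex.sub_re, Complex.re_ofReal_mul, Complex.I_mul_re, Complex.im_ofReal_mul]
  ring

theorem mixC_im (α s : ℝ) (A C : ℂ) :
    (mixC α s A C).im = Real.cos s * C.im - meanRoot α / α * Real.sin s * A.re := by
  rw [mixC, Complex.sub_im, Complex.im_ofReal_mul, Complex.I_mul_im, Complex.re_ofReal_mul]

/-- The mixing is unitary in the coordinates `√(α + 1) A`, `√α C`, hence stays on the level sphere.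
-/
theorem normSq_mix {α : ℝ} (hα : 0 < α) (s : ℝ) (A C : ℂ) :
    (α + 1) * Complex.normSq (mixA α s A C) + α * Complex.normSq (mixC α s A C)
      = (α + 1) * Complex.normSq A + α * Complex.normSq C := by
  have hm := meanRoot_sq hα
  have hβ : α + 1 ≠ 0 := by linarith
  have hs := Real.sin_sq s
  simp only [Complex.normSq_apply, mixA_re, mixA_im, mixC_re, mixC_im]
  field_simp
  ring_nf
  simp only [hm, hs]
  ring

/-- Conservation of the quadratic Hamiltonian `Re (A conj C)`; it keeps the phase speed constant
along the flow. -/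
theorem re_mix {α : ℝ} (hα : 0 < α) (s : ℝ) (A C : ℂ) :
    (mixA α s A C * (starRingEnd ℂ) (mixC α s A C)).re = (A * (starRingEnd ℂ) C).re := by
  have hm := meanRoot_sq hα
  have hβ : α + 1 ≠ 0 := by linarith
  have hs := Real.sin_sq s
  simp only [Complex.mul_re, Complex.conj_re, Complex.conj_im, mixA_re, mixA_im, mixC_re, mixC_im]
  field_simp
  ring_nf
  simp only [hm, hs]
  ring

theorem hasDerivAt_mixA {α : ℝ} (hα : 0 < α) (k t : ℝ) (A C : ℂ) :
    HasDerivAt (fun t => mixA α (k * t) A C)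
      (-((k * (meanRoot α / (α + 1)) : ℝ) * Complex.I * mixC α (k * t) A C)) t := by
  have hk : HasDerivAt (fun t => k * t) k t := by simpa using (hasDerivAt_id t).const_mul k
  have hs := (Real.hasDerivAt_sin (k * t)).comp t hk
  have hc := (Real.hasDerivAt_cos (k * t)).comp t hk
  have hβ : (α + 1 : ℂ) ≠ 0 := by exact_mod_cast (by linarith : α + 1 ≠ 0)
  have hα' : (α : ℂ) ≠ 0 := by exact_mod_cast hα.ne'
  have hm : (meanRoot α : ℂ) ^ 2 = α * (α + 1) := by exact_mod_cast meanRoot_sq hα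
  refine ((hc.ofReal_comp.mul_const A).sub
    (((hs.const_mul (meanRoot α / (α + 1))).ofReal_comp.mul_const C).const_mul
      Complex.I)).congr_deriv ?_
  simp only [mixC]
  push_cast
  field_simp
  ring_nf
  simp only [Complex.I_sq, hm]
  ring

theorem hasDerivAt_mixC {α : ℝ} (hα : 0 < α) (k t : ℝ) (A C : ℂ) :
    HasDerivAt (fun t => mixC α (k * t) A C)
      (-((k * (meanRoot α / α) : ℝ) * Complex.I * mixA α (k * t) A C)) t := by
  have hk : HasDerivAt (fun t => k * t) k t := by simpa using (hasDerivAt_id t).const_mul k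
  have hs := (Real.hasDerivAt_sin (k * t)).comp t hk
  have hc := (Real.hasDerivAt_cos (k * t)).comp t hk
  have hβ : (α + 1 : ℂ) ≠ 0 := by exact_mod_cast (by linarith : α + 1 ≠ 0)
  have hα' : (α : ℂ) ≠ 0 := by exact_mod_cast hα.ne'
  have hm : (meanRoot α : ℂ) ^ 2 = α * (α + 1) := by exact_mod_cast meanRoot_sq hα
  refine ((hc.ofReal_comp.mul_const C).sub
    (((hs.const_mul (meanRoot α / α)).ofReal_comp.mul_const A).const_mul
      Complex.I)).congr_deriv ?_
  simp only [mixA]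
  push_cast
  field_simp
  ring_nf
  simp only [Complex.I_sq, hm]
  ring

theorem contDiff_mixA (α k : ℝ) (A C : ℂ) : ContDiff ℝ ∞ fun t => mixA α (k * t) A C := by
  have h1 : ContDiff ℝ ∞ fun t : ℝ => Real.cos (k * t) := by fun_prop
  have h2 : ContDiff ℝ ∞ fun t : ℝ => meanRoot α / (α + 1) * Real.sin (k * t) := by fun_prop
  exact ((contDiff_ofReal_comp h1).mul contDiff_const).sub
    (contDiff_const.mul ((contDiff_ofReal_comp h2).mul contDiff_const))

theorem contDiff_mixC (α k : ℝ) (A C : ℂ) : ContDiff ℝ ∞ fun t => mixC α (k * t) A C := by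
  have h1 : ContDiff ℝ ∞ fun t : ℝ => Real.cos (k * t) := by fun_prop
  have h2 : ContDiff ℝ ∞ fun t : ℝ => meanRoot α / α * Real.sin (k * t) := by fun_prop
  exact ((contDiff_ofReal_comp h1).mul contDiff_const).sub
    (contDiff_const.mul ((contDiff_ofReal_comp h2).mul contDiff_const))

/-- The flow of `χ(μ) Re (Z₁ Z₂)`, for Darboux coordinates `Z₁`, `Z₂`, in terms of parameters. -/
def cornerCurve (α : ℝ) (χ : ℝ → ℝ) (μ : ℝ) (A C : ℂ) (t : ℝ) : S2xS2 :=
  cornerPoint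
    (mixA α (χ μ / 2 * t) A C * Complex.exp
      ((deriv χ μ * (meanRoot α * (A * (starRingEnd ℂ) C).re) * t : ℝ) * Complex.I))
    (mixC α (χ μ / 2 * t) A C * Complex.exp
      ((deriv χ μ * (meanRoot α * (A * (starRingEnd ℂ) C).re) * t : ℝ) * Complex.I))

/-- The flow of `χ(μ) Re (Z₁ Z₂)`, for Darboux coordinates `Z₁`, `Z₂`. -/
def cornerFlow (α : ℝ) (χ : ℝ → ℝ) (t : ℝ) (p : S2xS2) : S2xS2 :=
  cornerCurve α χ (moment α p) (cornerA p) (cornerC p) t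

theorem IsCornerParam.curve {α μ : ℝ} {A C : ℂ} (h : IsCornerParam α μ A C) (x s : ℝ) :
    IsCornerParam α μ (mixA α s A C * Complex.exp (x * Complex.I))
      (mixC α s A C * Complex.exp (x * Complex.I)) :=
  ⟨h.pos, h.lt, by
    rw [Complex.normSq_mul, Complex.normSq_mul, normSq_exp_ofReal_mul_I, mul_one, mul_one,
      normSq_mix h.pos, h.level]⟩

theorem cornerFlow_zero {α : ℝ} (hα : 0 < α) (χ : ℝ → ℝ) {p : S2xS2}
    (hp : 1 < moment α p) : cornerFlow α χ 0 p = p := by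
  conv_rhs => rw [← (isCornerParam_of_moment hα hp).2]
  simp only [cornerFlow, cornerCurve, mul_zero, mixA_zero, mixC_zero, Complex.ofReal_zero,
    zero_mul, Complex.exp_zero, mul_one]

theorem re_mul_conj_mul (A C c : ℂ) (hc : Complex.normSq c = 1) :
    (A * c * (starRingEnd ℂ) (C * c)).re = (A * (starRingEnd ℂ) C).re := by
  have : A * c * (starRingEnd ℂ) (C * c) = A * (starRingEnd ℂ) C * (Complex.normSq c : ℝ) := by
    rw [Complex.normSq_eq_conj_mul_self, map_mul]
    ring
  rw [this, hc, Complex.ofReal_one, mul_one]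

theorem cornerFlow_cornerFlow {α : ℝ} (hα : 0 < α) (χ : ℝ → ℝ) {p : S2xS2}
    (hp : 1 < moment α p) (s t : ℝ) :
    cornerFlow α χ s (cornerFlow α χ t p) = cornerFlow α χ (s + t) p := by
  have h := (isCornerParam_of_moment hα hp).1
  have h' := h.curve (deriv χ (moment α p)
    * (meanRoot α * (cornerA p * (starRingEnd ℂ) (cornerC p)).re) * t) (χ (moment α p) / 2 * t)
  conv_lhs => rw [cornerFlow.eq_def α χ t p, cornerCurve]
  rw [cornerFlow, h'.moment_eq, h'.cornerA_eq, h'.cornerC_eq, cornerFlow, cornerCurve, cornerCurve,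
    re_mul_conj_mul _ _ _ (normSq_exp_ofReal_mul_I _), re_mix hα]
  rw [mul_comm (mixA α _ (cornerA p) _) (Complex.exp _),
    mul_comm (mixC α _ (cornerA p) _) (Complex.exp _), mixA_smul, mixC_smul, mixA_mix hα,
    mixC_mix hα, ← mul_add]
  generalize deriv χ (moment α p)
    * (meanRoot α * (cornerA p * (starRingEnd ℂ) (cornerC p)).re) = x
  have hexp : ∀ Z : ℂ, Complex.exp ((x * t : ℝ) * Complex.I) * Z
      * Complex.exp ((x * s : ℝ) * Complex.I) = Z * Complex.exp ((x * (s + t) : ℝ) * Complex.I) := by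
    intro Z
    rw [mul_comm _ Z, mul_assoc, ← Complex.exp_add]
    push_cast
    ring_nf
  rw [hexp, hexp]

/-- Hamilton's equation for one factor as pure algebra, with `u + iv` in the role of `A conj C`. It
serves both factors. -/
theorem corner_identity {b X X' σ S S' n u v A C : ℂ} (hb : b ≠ 0) (hS : S ≠ 0) (hS' : S' ≠ 0)
    (hn : S ^ 2 = 2 - n) (hq : (u - v * Complex.I) * A = n * C) :
    b * (X * σ / b * v / (2 * S) * A
        + S * (X' * σ * u * Complex.I * A - X / 2 * (σ / b) * Complex.I * C))
      = Complex.I * (S * S' * u * (X' * b * (σ / (S * S')) - X * (σ / (2 * S ^ 3 * S'))) * (S * A)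
        - X * (σ / (S * S')) * (1 - n) * (S' * C)) := by
  field_simp
  linear_combination -(σ * X * Complex.I * C) * hn + σ * X * Complex.I * hq
    + σ * X * v * A * Complex.I_sq

theorem hasDerivAt_const_div_sqrt_one_add {a : ℝ} (c : ℝ) (ha : 0 < 1 + a) :
    HasDerivAt (fun a => c / Real.sqrt (1 + a)) (-(c / (2 * Real.sqrt (1 + a) ^ 3))) a := by
  have h1 : HasDerivAt (fun a : ℝ => 1 + a) 1 a := by
    simpa using (hasDerivAt_id a).const_add 1
  have hs := (Real.sqrt_pos.2 ha).ne'
  refine ((hasDerivAt_const a c).div (h1.sqrt ha.ne') hs).congr_deriv ?_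
  field_simp
  ring

theorem hasDerivAt_one_div_sqrt_one_sub {b : ℝ} (hb : 0 < 1 - b) :
    HasDerivAt (fun b => 1 / Real.sqrt (1 - b)) (1 / (2 * Real.sqrt (1 - b) ^ 3)) b := by
  have h1 : HasDerivAt (fun b : ℝ => 1 - b) (-1) b := by
    simpa using (hasDerivAt_id b).const_sub 1
  have hs := (Real.sqrt_pos.2 hb).ne'
  refine ((hasDerivAt_const b 1).div (h1.sqrt hb.ne') hs).congr_deriv ?_
  field_simp
  ring

theorem hasDerivAt_normSq {f : ℝ → ℂ} {f' : ℂ} {t : ℝ} (hf : HasDerivAt f f' t) :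
    HasDerivAt (fun t => Complex.normSq (f t)) (2 * ((starRingEnd ℂ) (f t) * f').re) t := by
  have h1 := Complex.reCLM.hasFDerivAt.comp_hasDerivAt t hf
  have h2 := Complex.imCLM.hasFDerivAt.comp_hasDerivAt t hf
  refine ((h1.mul h1).add (h2.mul h2)).congr_deriv ?_
  simp
  ring

theorem contDiff_normSq_comp {f : ℝ → ℂ} (hf : ContDiff ℝ ∞ f) :
    ContDiff ℝ ∞ fun t => Complex.normSq (f t) := by
  have h1 : ContDiff ℝ ∞ fun t => (f t).re := Complex.reCLM.contDiff.comp hf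
  have h2 : ContDiff ℝ ∞ fun t => (f t).im := Complex.imCLM.contDiff.comp hf
  exact (h1.mul h1).add (h2.mul h2)

theorem conj_eq_re_sub_im (q : ℂ) : (q.re : ℂ) - q.im * Complex.I = (starRingEnd ℂ) q := by
  apply Complex.ext <;> simp

theorem re_conj_mul_rotation_left (κ x : ℝ) (A C : ℂ) :
    ((starRingEnd ℂ) A * (κ * Complex.I * A - x * Complex.I * C)).re
      = -(x * (A * (starRingEnd ℂ) C).im) := by
  simp
  ring

theorem re_conj_mul_rotation_right (κ x : ℝ) (A C : ℂ) :
    ((starRingEnd ℂ) C * (κ * Complex.I * C - x * Complex.I * A)).re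
      = x * (A * (starRingEnd ℂ) C).im := by
  simp
  ring

/-- In the coordinates `A`, `C` the Hamiltonian is `χ(μ)` times the quadratic form `meanRoot α * Re
(A conj C)`, up to the factor `2π`. The quadratic form generates a linear unitary flow, and the
derivative of `χ` adds the common phase `κ t`. -/
theorem IsCornerParam.isProbeCurve {α μ : ℝ} {A₀ C₀ : ℂ} (h : IsCornerParam α μ A₀ C₀)
    {χ : ℝ → ℝ} (hχ : ContDiff ℝ ∞ χ) :
    IsProbeCurve α (probeFun α χ (fun a => meanRoot α / Real.sqrt (1 + a))
      fun b => 1 / Real.sqrt (1 - b)) (cornerCurve α χ μ A₀ C₀) := by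
  have hα : α ≠ 0 := h.pos.ne'
  have hβ : α + 1 ≠ 0 := by linarith [h.pos]
  set κ := deriv χ μ * (meanRoot α * (A₀ * (starRingEnd ℂ) C₀).re) with hκ
  set k := χ μ with hk
  set σ := meanRoot α with hσ
  set A : ℝ → ℂ := fun t =>
    mixA α (k / 2 * t) A₀ C₀ * Complex.exp ((κ * t : ℝ) * Complex.I) with hA
  set C : ℝ → ℂ := fun t =>
    mixC α (k / 2 * t) A₀ C₀ * Complex.exp ((κ * t : ℝ) * Complex.I) with hC
  set n : ℝ → ℝ := fun t => Complex.normSq (A t) with hn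
  set m : ℝ → ℝ := fun t => Complex.normSq (C t) with hm
  set R : ℝ → ℝ := fun t => Real.sqrt (2 - n t) with hR
  set S : ℝ → ℝ := fun t => Real.sqrt (2 - m t) with hS
  have hP : ∀ t, IsCornerParam α μ (A t) (C t) := fun t => h.curve _ _
  have hre : ∀ t, (A t * (starRingEnd ℂ) (C t)).re = (A₀ * (starRingEnd ℂ) C₀).re := fun t => by
    simp only [hA, hC]
    rw [re_mul_conj_mul _ _ _ (normSq_exp_ofReal_mul_I _), re_mix h.pos]
  have hc : cornerCurve α χ μ A₀ C₀ = fun t => cornerPoint (A t) (C t) := rfl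
  have z₁ : ∀ t, zeta (cornerPoint (A t) (C t)).1 = R t * A t := fun t => (hP t).zeta₁
  have z₂ : ∀ t, zeta (cornerPoint (A t) (C t)).2 = S t * (starRingEnd ℂ) (C t) :=
    fun t => (hP t).zeta₂
  have y₁ : ∀ t, height (cornerPoint (A t) (C t)).1 = 1 - n t := fun t => (hP t).height₁
  have y₂ : ∀ t, height (cornerPoint (A t) (C t)).2 = m t - 1 := fun t => (hP t).height₂
  have posR : ∀ t, 0 < 2 - n t := fun t => (hP t).radicand₁_pos
  have posS : ∀ t, 0 < 2 - m t := fun t => (hP t).radicand₂_pos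
  have cexp := contDiff_mul_exp 1 κ
  simp only [one_mul] at cexp
  have cA : ContDiff ℝ ∞ A := (contDiff_mixA _ _ _ _).mul cexp
  have cC : ContDiff ℝ ∞ C := (contDiff_mixC _ _ _ _).mul cexp
  have cn : ContDiff ℝ ∞ n := contDiff_normSq_comp cA
  have cm : ContDiff ℝ ∞ m := contDiff_normSq_comp cC
  have cR : ContDiff ℝ ∞ R := (contDiff_const.sub cn).sqrt fun t => (posR t).ne'
  have cS : ContDiff ℝ ∞ S := (contDiff_const.sub cm).sqrt fun t => (posS t).ne'
  rw [hc]
  refine ⟨?_, ?_, ?_, ?_, fun t => ?_⟩ <;> simp only [z₁, z₂, y₁, y₂]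
  · exact (contDiff_ofReal_comp cR).mul cA
  · exact (contDiff_ofReal_comp cS).mul (contDiff_conj_comp cC)
  · exact contDiff_const.sub cn
  · exact cm.sub contDiff_const
  set q : ℂ := A t * (starRingEnd ℂ) (C t) with hq
  have dexp := hasDerivAt_mul_exp 1 κ t
  simp only [one_mul] at dexp
  have dA : HasDerivAt A (κ * Complex.I * A t - (k / 2 * (σ / (α + 1)) : ℝ) * Complex.I * C t) t := by
    refine ((hasDerivAt_mixA h.pos (k / 2) t A₀ C₀).mul dexp).congr_deriv ?_
    simp only [hA, hC]
    ring
  have dC : HasDerivAt C (κ * Complex.I * C t - (k / 2 * (σ / α) : ℝ) * Complex.I * A t) t := by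
    refine ((hasDerivAt_mixC h.pos (k / 2) t A₀ C₀).mul dexp).congr_deriv ?_
    simp only [hA, hC]
    ring
  have dn : HasDerivAt n (-(k * σ / (α + 1) * q.im)) t := by
    refine (hasDerivAt_normSq dA).congr_deriv ?_
    rw [re_conj_mul_rotation_left, ← hq]
    ring
  have dm : HasDerivAt m (k * σ / α * q.im) t := by
    refine (hasDerivAt_normSq dC).congr_deriv ?_
    rw [re_conj_mul_rotation_right, ← hq]
    ring
  have hRne : R t ≠ 0 := (Real.sqrt_pos.2 (posR t)).ne'
  have hSne : S t ≠ 0 := (Real.sqrt_pos.2 (posS t)).ne'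
  have dR : HasDerivAt R (k * σ / (α + 1) * q.im / (2 * R t)) t := by
    refine ((dn.const_sub 2).sqrt (posR t).ne').congr_deriv ?_
    rw [neg_neg]
  have dS : HasDerivAt S (-(k * σ / α * q.im) / (2 * S t)) t :=
    (dm.const_sub 2).sqrt (posS t).ne'
  refine ⟨_, _, _, _, dR.ofReal_comp.mul dA, dS.ofReal_comp.mul (hasDerivAt_conj_comp dC),
    dn.const_sub 1, dm.sub_const 1, ?_⟩
  have hmom : (α + 1) * (1 - n t) - α * (m t - 1) = μ := by linarith [(hP t).level]
  have r₁ : Real.sqrt (1 + (1 - n t)) = R t := by rw [← add_sub_assoc]; norm_num [hR]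
  have r₂ : Real.sqrt (1 - (m t - 1)) = S t := by rw [← sub_add, sub_add_eq_add_sub]; norm_num [hS]
  have p₁ : 0 < 1 + (1 - n t) := by linarith [posR t]
  have p₂ : 0 < 1 - (m t - 1) := by linarith [posS t]
  obtain ⟨D₁, D₂⟩ := fderiv_probeFun (α := α) hχ (hasDerivAt_const_div_sqrt_one_add σ p₁)
    (hasDerivAt_one_div_sqrt_one_sub p₂)
  rw [hmom, r₁, r₂] at D₁ D₂
  rw [D₁, D₂, probeFun]
  simp only [hmom, r₁, r₂]
  have hmul : (R t : ℂ) * A t * (S t * (starRingEnd ℂ) (C t)) = (R t * S t : ℝ) * q := by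
    rw [hq]; push_cast; ring
  rw [hmul, Complex.re_ofReal_mul, Complex.im_ofReal_mul, ← hk]
  have hRne' : (R t : ℂ) ≠ 0 := by exact_mod_cast hRne
  have hSne' : (S t : ℂ) ≠ 0 := by exact_mod_cast hSne
  have hβ' : (α + 1 : ℂ) ≠ 0 := by exact_mod_cast hβ
  have hα' : (α : ℂ) ≠ 0 := by exact_mod_cast hα
  have hR2 : (R t : ℂ) ^ 2 = 2 - n t := by exact_mod_cast Real.sq_sqrt (posR t).le
  have hS2 : (S t : ℂ) ^ 2 = 2 - m t := by exact_mod_cast Real.sq_sqrt (posS t).le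
  have hκ' : (κ : ℂ) = (deriv χ μ : ℝ) * (σ * q.re) := by rw [hκ, ← hre t, ← hq]; push_cast; ring
  have q₁ : ((q.re : ℂ) - q.im * Complex.I) * A t = n t * C t := by
    rw [conj_eq_re_sub_im, hq, map_mul, Complex.conj_conj, hn]
    simp only [Complex.normSq_eq_conj_mul_self]
    ring
  have q₂ : ((q.re : ℂ) - q.im * Complex.I) * (starRingEnd ℂ) (C t)
      = m t * (starRingEnd ℂ) (A t) := by
    rw [conj_eq_re_sub_im, hq, map_mul, Complex.conj_conj, hm]
    simp only [Complex.normSq_eq_conj_mul_self]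
    ring
  refine ⟨?_, ?_, ?_, ?_⟩
  · have := corner_identity (X := k) (X' := (deriv χ μ : ℝ)) (σ := σ) hβ' hRne' hSne' hR2 q₁
    have c₁ : (starRingEnd ℂ) (S t * (starRingEnd ℂ) (C t)) = S t * C t := by
      rw [map_mul, Complex.conj_ofReal, Complex.conj_conj]
    rw [c₁, hκ']
    push_cast
    refine (Eq.trans ?_ this).trans ?_
    · ring
    · ring
  · have := corner_identity (X := -k) (X' := -(deriv χ μ : ℝ)) (σ := σ) hα' hSne' hRne' hS2 q₂
    have c₁ : (starRingEnd ℂ) (κ * Complex.I * C t - (k / 2 * (σ / α) : ℝ) * Complex.I * A t)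
        = -(κ * Complex.I) * (starRingEnd ℂ) (C t)
          + (k / 2 * (σ / α) : ℝ) * Complex.I * (starRingEnd ℂ) (A t) := by
      simp only [map_sub, map_mul, Complex.conj_ofReal, Complex.conj_I]
      ring
    have c₂ : (starRingEnd ℂ) (R t * A t) = R t * (starRingEnd ℂ) (A t) := by
      rw [map_mul, Complex.conj_ofReal]
    rw [c₁, c₂, hκ']
    push_cast
    refine (Eq.trans ?_ this).trans ?_
    · ring
    · ring
  · field_simp
  · field_simp

/-- The unitary rotation by a right angle exchanges `(α + 1)|A|² = α + 1 - x` with `α|C|² = α + y`,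
the distances to the two facets that the probe joins. -/
theorem hamIsotopic_corner {α : ℝ} (hα : 0 < α) {x y : ℝ} (hxy : 1 < x - y) :
    HamIsotopic α (splitTorus α x y) (splitTorus α (1 - y) (1 - x)) := by
  obtain ⟨χ, hχ, hs, hc⟩ := exists_cutoff (isOpen_Ioi (a := (1 : ℝ))) hxy
  have hα1 : α + 1 ≠ 0 := by linarith
  have hm2 := meanRoot_sq hα
  have hflow : ∀ s : ℝ, (s = 1 ∨ s = -1) → ∀ a b : ℝ, a - b = x - y → ∀ p ∈ splitTorus α a b,
      cornerFlow α χ s p ∈ splitTorus α (1 - b) (1 - a) := by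
    intro s hs' a b hab p hp
    rw [mem_splitTorus_iff hα] at hp
    have hm : moment α p = x - y := by rw [moment, hp.1, hp.2, hab]
    have hmp : 1 < moment α p := hm ▸ hxy
    have hP := (isCornerParam_of_moment hα hmp).1
    have hP' := hP.curve (deriv χ (moment α p)
      * (meanRoot α * (cornerA p * (starRingEnd ℂ) (cornerC p)).re) * s) (χ (moment α p) / 2 * s)
    -- The angle is `π / 2` because a rotation of `ℂ²` by `θ` covers a rotation of the reduced
    -- sphere by `2θ`.
    have hsin : Real.sin (Real.pi / 2 * s) ^ 2 = 1 := by
      rcases hs' with rfl | rfl <;> simp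
    have hcos : Real.cos (Real.pi / 2 * s) = 0 := by
      rcases hs' with rfl | rfl <;> simp
    have nA := normSq_cornerA (one_add_height_pos hα hmp)
    have nC := normSq_cornerC (one_sub_height_pos hα hmp)
    rw [Complex.normSq_apply] at nA nC
    rw [mem_splitTorus_iff hα, cornerFlow, cornerCurve, hP'.height₁, hP'.height₂, hm, hc,
      Complex.normSq_mul, Complex.normSq_mul, normSq_exp_ofReal_mul_I, mul_one, mul_one]
    simp only [Complex.normSq_apply, mixA_re, mixA_im, mixC_re, mixC_im, hcos]
    generalize Real.sin (Real.pi / 2 * s) = u at hsin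
    have e₁ : meanRoot α / (α + 1) * (meanRoot α / (α + 1)) * (α + 1) = α := by
      field_simp
      linarith
    have e₂ : meanRoot α / α * (meanRoot α / α) * α = α + 1 := by
      field_simp
      linarith
    constructor
    · linear_combination hp.2 * (-1) - u ^ 2 * ((cornerC p).re ^ 2 + (cornerC p).im ^ 2) * e₁
        - α * ((cornerC p).re ^ 2 + (cornerC p).im ^ 2) * hsin - α * nC
    · linear_combination hp.1 * (-1) + u ^ 2 * ((cornerA p).re ^ 2 + (cornerA p).im ^ 2) * e₂
        + (α + 1) * ((cornerA p).re ^ 2 + (cornerA p).im ^ 2) * hsin + (α + 1) * nA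
  refine hamIsotopic_of_localFlow hα hχ hs (Φ := cornerFlow α χ)
    (f := fun a => meanRoot α / Real.sqrt (1 + a)) (g := fun b => 1 / Real.sqrt (1 - b))
    (fun q hq => ?_) (fun q hq => ?_) (fun p hp => cornerFlow_zero hα χ hp)
    (fun p hp => (isCornerParam_of_moment hα hp).1.isProbeCurve hχ) (fun p hp => ?_) hxy (by ring)
    (hflow 1 (Or.inl rfl) x y rfl) (fun p hp => ?_)
  · have h1 := one_add_height_pos hα hq
    exact contDiffAt_const.div ((contDiffAt_const.add contDiffAt_id).sqrt h1.ne')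
      (Real.sqrt_pos.2 h1).ne'
  · have h1 := one_sub_height_pos hα hq
    exact contDiffAt_const.div ((contDiffAt_const.sub contDiffAt_id).sqrt h1.ne')
      (Real.sqrt_pos.2 h1).ne'
  · rw [cornerFlow_cornerFlow hα χ hp, add_neg_cancel, cornerFlow_zero hα χ hp]
  · have h := hflow (-1) (Or.inr rfl) (1 - y) (1 - x) (by ring) p hp
    convert h using 2 <;> ring

/-! ### The orbit of a split torus -/

section orbit

variable {α y : ℝ}

/-- The route is `(1 + s, y)`, `(1 + s, -y)`, `(1 + y, -s)`, `(1 + y, s)`, `(1 - s, -y)`, `(1 - s,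
y)`. The two corner moves need `-y < s` and `s < y`. -/
theorem hamIsotopic_reflect (hα : 0 < α) {s : ℝ} (hs : |s| < y) :
    HamIsotopic α (splitTorus α (1 + s) y) (splitTorus α (1 - s) y) := by
  obtain ⟨h1, h2⟩ := abs_lt.1 hs
  have a₁ := hamIsotopic_neg_right hα (1 + s) y
  have a₂ := hamIsotopic_corner hα (x := 1 + s) (y := -y) (by linarith)
  have a₃ := hamIsotopic_neg_right hα (1 - -y) (1 - (1 + s))
  have a₄ := hamIsotopic_corner hα (x := 1 - -y) (y := -(1 - (1 + s))) (by linarith)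
  have a₅ := hamIsotopic_neg_right hα (1 - -(1 - (1 + s))) (1 - (1 - -y))
  have := (((a₁.trans a₂).trans a₃).trans a₄).trans a₅
  convert this using 2 <;> ring

theorem hamIsotopic_translate_left (hα : 0 < α) {x : ℝ} (hx : |x - y| < 1) :
    HamIsotopic α (splitTorus α x y) (splitTorus α (x - 2 * y) y) := by
  have := (hamIsotopic_shear hα hx).trans (hamIsotopic_neg_right hα _ _)
  rwa [neg_neg] at this

theorem hamIsotopic_translate_right (hα : 0 < α) {x : ℝ} (hx : |x + y| < 1) :
    HamIsotopic α (splitTorus α x y) (splitTorus α (x + 2 * y) y) := by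
  have h : |-x - y| < 1 := by rwa [← abs_neg, neg_sub, sub_neg_eq_add, add_comm]
  have := ((hamIsotopic_neg_left hα x y).trans (hamIsotopic_translate_left hα h)).trans
    (hamIsotopic_neg_left hα _ _)
  convert this using 2
  ring

/-- A step by `2y` with both ends in `(-1 - y, 1 + y)` has its midpoint in `(-1, 1)`, which is the
condition for a shear. The induction carries both directions. -/
theorem hamIsotopic_translate_nat (hα : 0 < α) (hy : 0 < y) (m : ℕ) :
    ∀ x : ℝ, -1 - y < x → x + 2 * y * m < 1 + y →
      HamIsotopic α (splitTorus α x y) (splitTorus α (x + 2 * y * m) y) ∧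
      HamIsotopic α (splitTorus α (x + 2 * y * m) y) (splitTorus α x y) := by
  induction m with
  | zero => intro x _ _; simp [HamIsotopic.refl]
  | succ m ih =>
    intro x h1 h2
    push_cast at h2 ⊢
    have hm : 0 ≤ 2 * y * m := by positivity
    have habs : |x + y| < 1 := abs_lt.2 ⟨by linarith, by linarith⟩
    have habs' : |x + 2 * y - y| < 1 := abs_lt.2 ⟨by linarith, by linarith⟩
    obtain ⟨i₁, i₂⟩ := ih (x + 2 * y) (by linarith) (by linarith)
    have e : x + 2 * y * (m + 1) = x + 2 * y + 2 * y * m := by ring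
    rw [e]
    refine ⟨(hamIsotopic_translate_right hα habs).trans i₁, i₂.trans ?_⟩
    have := hamIsotopic_translate_left hα habs'
    rwa [add_sub_cancel_right] at this

theorem hamIsotopic_translate (hα : 0 < α) (hy : 0 < y) {x x' : ℝ} (m : ℤ)
    (hm : x' = x + 2 * y * m) (hx : x ∈ Set.Ioo (-1 - y) (1 + y))
    (hx' : x' ∈ Set.Ioo (-1 - y) (1 + y)) :
    HamIsotopic α (splitTorus α x y) (splitTorus α x' y) := by
  obtain ⟨n, rfl | rfl⟩ := m.eq_nat_or_neg
  · push_cast at hm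
    have := (hamIsotopic_translate_nat hα hy n x hx.1 (hm ▸ hx'.2)).1
    rwa [← hm] at this
  · push_cast at hm
    have hx2 : x = x' + 2 * y * n := by rw [hm]; ring
    have := (hamIsotopic_translate_nat hα hy n x' hx'.1 (hx2 ▸ hx.2)).2
    rwa [← hx2] at this

/-- Reflection at `0` followed by reflection at `1` adds `2` to the first coordinate; the
translation in between brings it back to where the second reflection is available. -/
theorem hamIsotopic_add_two (hα : 0 < α) (hy : 0 < y) {s s' : ℝ} (hs : |s| < y) (hs' : |s'| < y)
    (m : ℤ) (h : s' = s + 2 + 2 * y * m) :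
    HamIsotopic α (splitTorus α (1 + s) y) (splitTorus α (1 + s') y) := by
  obtain ⟨h1, h2⟩ := abs_lt.1 hs
  obtain ⟨h1', h2'⟩ := abs_lt.1 hs'
  have a₁ := hamIsotopic_neg_left hα (1 + s) y
  have a₂ := hamIsotopic_translate hα hy (x := -(1 + s)) (x' := 1 - s') (-m)
    (by rw [h]; push_cast; ring) ⟨by linarith, by linarith⟩ ⟨by linarith, by linarith⟩
  have a₃ := hamIsotopic_reflect hα (s := -s') (by rwa [abs_neg])
  rw [← sub_eq_add_neg, sub_neg_eq_add] at a₃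
  exact (a₁.trans a₂).trans a₃

theorem hamIsotopic_sub_two (hα : 0 < α) (hy : 0 < y) {s s' : ℝ} (hs : |s| < y) (hs' : |s'| < y)
    (m : ℤ) (h : s' = s - 2 + 2 * y * m) :
    HamIsotopic α (splitTorus α (1 + s) y) (splitTorus α (1 + s') y) := by
  obtain ⟨h1, h2⟩ := abs_lt.1 hs
  obtain ⟨h1', h2'⟩ := abs_lt.1 hs'
  have a₁ := hamIsotopic_reflect hα hs
  have a₂ := hamIsotopic_neg_left hα (1 - s) y
  have a₃ := hamIsotopic_translate hα hy (x := -(1 - s)) (x' := 1 + s') m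
    (by rw [h]; ring) ⟨by linarith, by linarith⟩ ⟨by linarith, by linarith⟩
  exact (a₁.trans a₂).trans a₃

/-- Rounding `n / y` gives the bound with `≤`. Equality would make `2n` an odd multiple of `y`,
against irrationality. -/
theorem exists_abs_add_lt (hy : 0 < y) (hirr : Irrational y) (n : ℤ) :
    ∃ k : ℤ, |2 * (n : ℝ) + 2 * y * k| < y := by
  refine ⟨-round ((n : ℝ) / y), ?_⟩
  have hle := abs_sub_round ((n : ℝ) / y)
  set r := round ((n : ℝ) / y)
  have hne : |(n : ℝ) / y - r| ≠ 1 / 2 := by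
    intro h
    have hn : (2 * n : ℝ) = y * ((2 * r + 1 : ℤ) : ℝ) ∨ (2 * n : ℝ) = y * ((2 * r - 1 : ℤ) : ℝ) := by
      rcases (abs_eq (by norm_num)).1 h with h | h
      · left
        field_simp at h
        push_cast
        linarith
      · right
        field_simp at h
        push_cast
        linarith
    have hodd : ∀ j : ℤ, j ≠ 0 → (2 * n : ℝ) ≠ y * j := by
      intro j hj h
      have := hirr.mul_intCast hj
      rw [← h] at this
      exact this ⟨2 * n, by push_cast; ring⟩
    rcases hn with hn | hn
    · exact hodd _ (by omega) hn
    · exact hodd _ (by omega) hn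
  have hlt : |(n : ℝ) / y - r| < 1 / 2 := lt_of_le_of_ne hle hne
  have e : 2 * (n : ℝ) + 2 * y * (-r : ℤ) = 2 * y * ((n : ℝ) / y - r) := by
    push_cast
    field_simp
    ring
  rw [e, abs_mul, abs_of_pos (by positivity : 0 < 2 * y)]
  nlinarith

/-- Each step of the induction changes `s` by `±2` and corrects by a multiple of `2y`.
`exists_abs_add_lt` supplies an admissible intermediate torus for every `n`. -/
theorem hamIsotopic_orbit (hα : 0 < α) (hy : 0 < y) (hirr : Irrational y) (n : ℤ) :
    ∀ k : ℤ, |2 * (n : ℝ) + 2 * y * k| < y →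
      HamIsotopic α (splitTorus α 1 y) (splitTorus α (1 + (2 * n + 2 * y * k)) y) := by
  induction n using Int.induction_on with
  | zero =>
    intro k hk
    have h0 : |(0 : ℝ)| < y := by simpa using hy
    have := hamIsotopic_translate hα hy (x := 1) (x' := 1 + (2 * ((0 : ℤ) : ℝ) + 2 * y * k)) k
      (by push_cast; ring) ⟨by linarith, by linarith⟩
      ⟨by linarith [(abs_lt.1 hk).1], by linarith [(abs_lt.1 hk).2]⟩
    exact this
  | succ n ih =>
    intro k hk
    obtain ⟨k₀, hk₀⟩ := exists_abs_add_lt hy hirr n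
    exact (ih k₀ hk₀).trans (hamIsotopic_add_two hα hy hk₀ hk (k - k₀) (by push_cast; ring))
  | pred n ih =>
    intro k hk
    obtain ⟨k₀, hk₀⟩ := exists_abs_add_lt hy hirr (-n)
    exact (ih k₀ hk₀).trans (hamIsotopic_sub_two hα hy hk₀ hk (k - k₀) (by push_cast; ring))

end orbit

/-! ### Split tori near a given one -/

theorem splitTorus_nonempty {α x y : ℝ} (hα : 0 < α) (hx : x ∈ Set.Ioo (-1 - α) (1 + α))
    (hy : y ∈ Set.Ioo (-α) α) : (splitTorus α x y).Nonempty := by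
  have key : ∀ z : ℝ, |z| < 1 → ∃ p : S2, height p = z := by
    intro z hz
    have hz' : 0 ≤ 1 - z ^ 2 := by linarith [(sq_lt_one_iff_abs_lt_one z).2 hz]
    refine ⟨spherePoint (Real.sqrt (1 - z ^ 2)) z ?_, rfl⟩
    rw [Complex.normSq_ofReal, Real.mul_self_sqrt hz']
    ring
  have hβ : 0 < α + 1 := by linarith
  obtain ⟨p, hp⟩ := key (x / (α + 1)) (by
    rw [abs_lt, lt_div_iff₀ hβ, div_lt_iff₀ hβ]
    constructor <;> linarith [hx.1, hx.2])
  obtain ⟨q, hq⟩ := key (y / α) (by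
    rw [abs_lt, lt_div_iff₀ hα, div_lt_iff₀ hα]
    constructor <;> linarith [hy.1, hy.2])
  refine ⟨(p, q), (mem_splitTorus_iff hα _ _ _).2 ⟨?_, ?_⟩⟩
  · simp only [hp]; field_simp
  · simp only [hq]; field_simp

theorem continuous_height : Continuous height := by
  have h : Continuous fun p : S2 => (p : E3) 2 := by fun_prop
  exact h

/-- The `ℓ¹` distance of the moment coordinates from `(x, y)` attains a positive minimum on the
compact complement of `W`; this minimum is `δ`. -/
theorem exists_splitTorus_subset {α x y : ℝ} (hα : 0 < α) {W : Set S2xS2} (hW : IsOpen W)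
    (hL : splitTorus α x y ⊆ W) :
    ∃ δ > 0, ∀ x' : ℝ, |x' - x| < δ → splitTorus α x' y ⊆ W := by
  have : CompactSpace S2 := inferInstance
  have hK : IsCompact Wᶜ := hW.isClosed_compl.isCompact
  have hf : Continuous fun p : S2xS2 => |(α + 1) * height p.1 - x| + |α * height p.2 - y| := by
    have := continuous_height
    fun_prop
  rcases Wᶜ.eq_empty_or_nonempty with h | h
  · refine ⟨1, one_pos, fun x' _ p _ => ?_⟩
    rw [Set.compl_empty_iff] at h
    rw [h]
    trivial
  · obtain ⟨p₀, hp₀, hmin⟩ := hK.exists_isMinOn h hf.continuousOn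
    refine ⟨|(α + 1) * height p₀.1 - x| + |α * height p₀.2 - y|, ?_, fun x' hx' p hp => ?_⟩
    · refine lt_of_le_of_ne (by positivity) fun h0 => hp₀ (hL ?_)
      have h1 := abs_nonneg ((α + 1) * height p₀.1 - x)
      have h2 := abs_nonneg (α * height p₀.2 - y)
      rw [mem_splitTorus_iff hα]
      exact ⟨sub_eq_zero.1 (abs_eq_zero.1 (by linarith)),
        sub_eq_zero.1 (abs_eq_zero.1 (by linarith))⟩
    · by_contra hpW
      have h1 := hmin hpW
      rw [mem_splitTorus_iff hα] at hp
      simp only [Set.mem_ofPred_eq, hp.1, hp.2, sub_self, abs_zero, add_zero] at h1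
      linarith

end

/-! ### Density of `2ℤ + 2yℤ` and the conclusion -/

theorem corollary1p4 (α : ℝ) (hα : 0 < α) :
    ∃ L : Set S2xS2, IsSplitTorus α L ∧
      ∀ W : Set S2xS2, IsWeinsteinNhd α L W →
        {L' : Set S2xS2 | IsSplitTorus α L' ∧ L' ⊆ W ∧ HamIsotopic α L L' ∧
          L ∩ L' = ∅}.Infinite := by
  obtain ⟨y, hirr, hy0, hyα⟩ := exists_irrational_btwn hα
  have hyI : y ∈ Set.Ioo (-α) α := ⟨by linarith, hyα⟩
  -- The first coordinate is `1` because this is the centre of the reflection `1 + s ↦ 1 - s`.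
  refine ⟨splitTorus α 1 y, ⟨1, ⟨by linarith, by linarith⟩, y, hyI, rfl⟩, fun W hW => ?_⟩
  obtain ⟨V, Ψ, -, hV, -, -, -, hL, hΨ, hWo⟩ := hW
  have hLW : splitTorus α 1 y ⊆ W := by
    rw [← hL, ← hΨ]
    exact Set.image_mono hV
  obtain ⟨δ, hδ, hsub⟩ := exists_splitTorus_subset hα hWo hLW
  -- The bound `δ` keeps the torus in `W`, `y` makes `hamIsotopic_orbit` applicable, and `α` keeps
  -- `1 + s` below `1 + α`.
  set ε := min δ (min y α) with hε
  have hε0 : 0 < ε := lt_min hδ (lt_min hy0 hα)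
  have hεδ : ε ≤ δ := min_le_left _ _
  have hεy : ε ≤ y := (min_le_right _ _).trans (min_le_left _ _)
  have hεα : ε ≤ α := (min_le_right _ _).trans (min_le_right _ _)
  set G : Set ℝ := ((AddSubgroup.closure {(2 : ℝ), 2 * y} : AddSubgroup ℝ) : Set ℝ) with hG
  have hGd : Dense G := by
    rw [hG, dense_addSubgroupClosure_pair_iff]
    have : (2 : ℝ) / (2 * y) = y⁻¹ := by field_simp
    rw [this]
    exact hirr.inv
  -- A dense subset of `ℝ` stays dense without finitely many points, so it cannot meet an interval
  -- in a finite set.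
  have hinf : (Set.Ioo 0 ε ∩ G).Infinite := by
    intro hfin
    obtain ⟨s, hs, hsG, hsn⟩ := (hGd.sdiff_finite hfin).inter_open_nonempty _ isOpen_Ioo
      (Set.nonempty_Ioo.2 hε0)
    exact hsn ⟨hs, hsG⟩
  have hne : ∀ s ∈ Set.Ioo 0 ε, (splitTorus α (1 + s) y).Nonempty := fun s hs =>
    splitTorus_nonempty hα ⟨by linarith [hs.1], by linarith [hs.2]⟩ hyI
  have hinj : Set.InjOn (fun s => splitTorus α (1 + s) y) (Set.Ioo 0 ε ∩ G) := by
    intro s hs s' _ hss'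
    obtain ⟨p, hp⟩ := hne s hs.1
    have hp' : p ∈ splitTorus α (1 + s') y := (Set.ext_iff.1 hss' p).1 hp
    rw [mem_splitTorus_iff hα] at hp hp'
    linarith [hp.1, hp'.1]
  refine (hinf.image hinj).mono ?_
  rintro _ ⟨s, ⟨hs, hsG⟩, rfl⟩
  obtain ⟨n, k, hnk⟩ := AddSubgroup.mem_closure_pair.1 hsG
  have hs' : s = 2 * n + 2 * y * k := by
    rw [← hnk, zsmul_eq_mul, zsmul_eq_mul]
    ring
  refine ⟨⟨1 + s, ⟨by linarith [hs.1], by linarith [hs.2]⟩, y, hyI, rfl⟩, hsub _ ?_, ?_, ?_⟩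
  · rw [add_sub_cancel_left, abs_of_pos hs.1]
    linarith [hs.2]
  · have := hamIsotopic_orbit hα hy0 hirr n k (by
      rw [← hs', abs_of_pos hs.1]
      linarith [hs.2])
    rwa [← hs'] at this
  · ext p
    simp only [Set.mem_inter_iff, Set.mem_empty_iff_false, iff_false, not_and]
    intro h1 h2
    rw [mem_splitTorus_iff hα] at h1 h2
    linarith [h1.1, h2.1, hs.1]
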